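/- Let $L\ge 2$ be an even integer, let $\Lambda=\{0,\dots,L-1\}^2$ be the two-dimensional torus of side $L$ with its Euclidean metric, and let $\mathcal S=\{-1,+1\}^\Lambda$. Fix $h\in(0,1)$. For $\beta>0$ consider the Markov chain $(\sigma_t)_{t=0,1,\dots}$ on $\mathcal S$ with transition matrix $$p(\sigma,\eta)=\prod_{x\in\Lambda}\frac{1}{1+\exp\{-2\beta\,\eta(x)\,(S_\sigma(x)+h)\}},\qquad S_\sigma(x)=\sum_{y\in\Lambda:\,|x-y|=1}\sigma(y),$$ and let $\mathbb P_\sigma$ be the law of the chain started at $\sigma$. For $A\subset\mathcal S$ let $\tau_A=\inf\{t>0:\sigma_t\in A\}$ be the first hitting time of $A$ (with $\inf\emptyset=\infty$). Let $\mathbf u\equiv+1$ and $\mathbf d\equiv-1$ be the two constant configurations, and let $\mathbf c=\{\mathbf c^{\mathrm e},\mathbf c^{\mathrm o}\}$ be the set of the two checkerboard configurations $\mathbf c^{\mathrm e}(x)=(-1)^{x_1+x_2}$, $\mathbf c^{\mathrm o}(x)=(-1)^{x_1+x_2+1}$. Then there exist $\lambda>0$ and $\beta_0>0$ (which may depend on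 $L$ and $h$, but not on $\beta$) such that for every $\beta>\beta_0$ $$\mathbb P_{\mathbf d}(\tau_{\mathbf u}<\tau_{\mathbf c})\le e^{-\beta\lambda}.$$ -/

import Mathlib

open MeasureTheory ProbabilityTheory

namespace PCA

/-- The sites of the two-dimensional discrete torus of side length `L`. -/
abbrev Site (L : ℕ) : Type := ZMod L × ZMod L

/-- The configurations: a spin `-1` or `+1` (a unit of `ℤ`) at every site of the torus. -/
abbrev Config (L : ℕ) : Type := Site L → ℤˣ

/-- The Euclidean length `|z|` on the torus of a displacement `z`; each coordinate is
represented by its residue of least absolute value. -/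
noncomputable def torusLength {L : ℕ} (z : Site L) : ℝ :=
  Real.sqrt ((z.1.valMinAbs : ℝ) ^ 2 + (z.2.valMinAbs : ℝ) ^ 2)

open scoped Classical in
/-- The nearest-neighbor kernel: `K z = 1` if `|z| = 1` and `K z = 0` otherwise. -/
noncomputable def K {L : ℕ} (z : Site L) : ℝ :=
  if torusLength z = 1 then 1 else 0

/-- The interaction part `S_σ(x) = ∑ y, K (x - y) σ(y)` of the local field. -/
noncomputable def S {L : ℕ} [NeZero L] (σ : Config L) (x : Site L) : ℝ :=
  ∑ y : Site L, K (x - y) * ((σ y : ℤ) : ℝ)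

/-- The probability `p_{x,σ}(s)` that the spin at `x` is updated to `s`, at inverse temperature
`β` and external field `h`, when the current configuration is `σ`. -/
noncomputable def siteProb {L : ℕ} [NeZero L] (β h : ℝ) (x : Site L) (σ : Config L) (s : ℤˣ) :
    ℝ :=
  1 / (1 + Real.exp (-2 * β * ((s : ℤ) : ℝ) * (S σ x + h)))

/-- The transition matrix: all the spins are updated simultaneously and independently. -/
noncomputable def p {L : ℕ} [NeZero L] (β h : ℝ) (σ η : Config L) : ℝ :=
  ∏ x : Site L, siteProb β h x σ (η x)

theorem siteProb_nonneg {L : ℕ} [NeZero L] (β h : ℝ) (x : Site L) (σ : Config L) (s : ℤˣ) :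
    0 ≤ siteProb β h x σ s := by
  unfold siteProb; positivity

theorem sum_siteProb {L : ℕ} [NeZero L] (β h : ℝ) (x : Site L) (σ : Config L) :
    ∑ s : ℤˣ, siteProb β h x σ s = 1 := by
  have hu : (Finset.univ : Finset ℤˣ) = {1, -1} := by decide
  rw [hu, Finset.sum_pair (by decide)]
  simp only [siteProb, Units.val_one, Units.val_neg, Int.cast_one, Int.cast_neg]
  have e : -2 * β * -1 * (S σ x + h) = -(-2 * β * 1 * (S σ x + h)) := by ring
  rw [e, Real.exp_neg]
  have hp := Real.exp_pos (-2 * β * 1 * (S σ x + h))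
  field_simp
  ring

theorem p_nonneg {L : ℕ} [NeZero L] (β h : ℝ) (σ η : Config L) : 0 ≤ p β h σ η :=
  Finset.prod_nonneg fun x _ => siteProb_nonneg β h x σ (η x)

theorem sum_p {L : ℕ} [NeZero L] (β h : ℝ) (σ : Config L) : ∑ η : Config L, p β h σ η = 1 := by
  unfold p
  rw [← Fintype.piFinset_univ,
    ← Finset.prod_univ_sum (fun _ : Site L => (Finset.univ : Finset ℤˣ))
      (fun x s => siteProb β h x σ s)]
  exact Finset.prod_eq_one fun x _ => sum_siteProb β h x σ

instance : MeasurableSingletonClass ℤˣ where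
  measurableSet_singleton s := ⟨{(s : ℤ)}, MeasurableSet.of_discrete, by
    ext t; simp [Units.ext_iff]⟩

/-- The transition matrix as a Markov kernel: `σ` is mapped to the law `p(σ, ·)`. -/
noncomputable def stepKernel {L : ℕ} [NeZero L] (β h : ℝ) : Kernel (Config L) (Config L) :=
  Kernel.ofFunOfCountable fun σ =>
    ∑ η : Config L, ENNReal.ofReal (p β h σ η) • Measure.dirac η

instance {L : ℕ} [NeZero L] (β h : ℝ) : IsMarkovKernel (stepKernel (L := L) β h) where
  isProbabilityMeasure σ := ⟨by
    change (∑ η : Config L, ENNReal.ofReal (p β h σ η) • Measure.dirac η) Set.univ = 1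
    simp only [Measure.finsetSum_apply, Measure.smul_apply, measure_univ, smul_eq_mul, mul_one]
    rw [← ENNReal.ofReal_sum_of_nonneg fun η _ => p_nonneg β h σ η, sum_p, ENNReal.ofReal_one]⟩

/-- The step from the trajectory up to time `n` to the configuration at time `n + 1`; it depends
on the configuration at time `n` only. -/
noncomputable def trajStep {L : ℕ} [NeZero L] (β h : ℝ) (n : ℕ) :
    Kernel ((i : Finset.Iic n) → (fun _ : ℕ => Config L) i) ((fun _ : ℕ => Config L) (n + 1)) :=
  (stepKernel β h).comap (fun ω => ω ⟨n, Finset.mem_Iic.2 le_rfl⟩) (measurable_pi_apply _)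

instance {L : ℕ} [NeZero L] (β h : ℝ) (n : ℕ) : IsMarkovKernel (trajStep (L := L) β h n) :=
  inferInstanceAs (IsMarkovKernel ((stepKernel β h).comap _ _))

/-- The probability measure `ℙ_σ` on the space of trajectories of the chain started at `σ`. -/
noncomputable def pathLaw {L : ℕ} [NeZero L] (β h : ℝ) (σ : Config L) : Measure (ℕ → Config L) :=
  Kernel.trajMeasure (X := fun _ : ℕ => Config L) (Measure.dirac σ) (trajStep β h)

/-- The first hitting time `τ_A = inf {t > 0 : σ_t ∈ A}` (`⊤` if `A` is never hit at a positive
time). -/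
noncomputable def hitTime {L : ℕ} (A : Set (Config L)) : (ℕ → Config L) → WithTop ℕ :=
  hittingAfter (fun t ω => ω t) A 1

/-- The configuration with all the spins equal to `+1`. -/
def u (L : ℕ) : Config L := fun _ => 1

/-- The configuration with all the spins equal to `-1`. -/
def d (L : ℕ) : Config L := fun _ => -1

/-- The even checkerboard, `x ↦ (-1) ^ (x₁ + x₂)` with `x₁, x₂ ∈ {0, …, L - 1}`. -/
def ce (L : ℕ) : Config L := fun x => (-1) ^ (x.1.val + x.2.val)

/-- The odd checkerboard, `x ↦ (-1) ^ (x₁ + x₂ + 1)` with `x₁, x₂ ∈ {0, …, L - 1}`. -/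
def co (L : ℕ) : Config L := fun x => (-1) ^ (x.1.val + x.2.val + 1)

/-- The pair of the checkerboard configurations. -/
def c (L : ℕ) : Set (Config L) := {ce L, co L}

end PCA

/-! Since `L` is even, the spins of one sublattice at time t + 1 depend only on the other sublattice
at time t. Folding the odd sublattice onto the even one, the dynamics becomes two independent copies
of one chain on half-configurations, exchanged at every step (`p_configEquiv`). Write m = -1 and p =
1 for its constant states: `d` is (m, m), `u` is (p, p), the checkerboards are (p, m) and (m, p).
For `u` to come before the checkerboards, the first time one copy is at p must find the other copy
off m. By independence this has probability at most about 2qG, where q bounds, uniformly in time,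
the probability of first reaching p at a given time, and G is the expected time spent off m before p
(`pairBound_le`).

The half chain is reversible with conductances exp(-2βH(a, b)), H being the Ising energy of the
configuration glued from a and b. Its paths below a level correspond to single-flip Ising paths
below that level (`conn_of_left_eq`, `reach_of_conn`). Let c be the barrier between m and p. A
last-exit decomposition and a cut give q ≤ C exp(-2βc) (`exists_firstEntry_le`). A Dirichlet
estimate bounds the expected number of visits to a by a constant times μ(a)/k, with k the least
conductance on a path to p from a or from m (`green_le_of_pathBound`). As μ(a) is of order
exp(-2βE), with E the least energy of a configuration having a as one half, qG is exponentially
small provided the path stays strictly below E + c. For E > 0 the path from m at height c will do.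
For E ≤ 0 the only well of depth c or more has to be that of m.

That last fact is `exists_barrier`, proved without computing c. Let r be a smallest droplet of
nonpositive energy that can be grown from one point x without exceeding c. By submodularity and
minimality, superposing this growth on a set t containing x climbs by less than c, and if nothing
lower than t is met then r ⊆ t. Since r contains a neighbor of x and the symmetries act transitively
on arcs, a nonempty set from which no progress is possible is closed under taking neighbors, hence
is the whole torus. -/

namespace Submodular

/-! ### Energy landscapes of submodular set functions -/

variable {X : Type*} [DecidableEq X]

/-- `s` and `t` differ in at most one point. -/
def Flip (s t : Finset X) : Prop := ∃ x, s.erase x = t.erase x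

/-- `s` and `t` are joined by a path of flips along which `V` stays at most `c`. -/
def Conn (V : Finset X → ℝ) (c : ℝ) : Finset X → Finset X → Prop :=
  Relation.ReflTransGen fun s t => Flip s t ∧ V s ≤ c ∧ V t ≤ c

/-- `t` is obtained from `s` by adding points one by one while `V` stays at most `c`. -/
def Up (V : Finset X → ℝ) (c : ℝ) : Finset X → Finset X → Prop :=
  Relation.ReflTransGen fun s t => (∃ x, t = insert x s) ∧ V s ≤ c ∧ V t ≤ c

theorem Flip.symm {s t : Finset X} (h : Flip s t) : Flip t s := h.imp fun _ hx => hx.symm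

theorem flip_insert (x : X) (s : Finset X) : Flip s (insert x s) :=
  ⟨x, by ext y; by_cases h : y = x <;> simp [h]⟩

theorem Flip.eq_or {s t : Finset X} (h : Flip s t) :
    ∃ x, t = insert x s ∨ t = s.erase x := by
  obtain ⟨x, hx⟩ := h
  refine ⟨x, ?_⟩
  by_cases hxt : x ∈ t
  · left
    rw [← Finset.insert_erase hxt, ← hx]
    ext y; by_cases h : y = x <;> simp [h]
  · right
    rw [hx, Finset.erase_eq_of_notMem hxt]

theorem Conn.symm {V : Finset X → ℝ} {c : ℝ} {s t : Finset X} (h : Conn V c s t) :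
    Conn V c t s := by
  induction h with
  | refl => exact .refl
  | tail _ h ih => exact .head ⟨h.1.symm, h.2.2, h.2.1⟩ ih

theorem Conn.mono {V : Finset X → ℝ} {c c' : ℝ} (hc : c ≤ c') {s t : Finset X}
    (h : Conn V c s t) : Conn V c' s t :=
  Relation.ReflTransGen.mono
    (fun _ _ h => ⟨h.1, h.2.1.trans hc, h.2.2.trans hc⟩) _ _ h

theorem Conn.step {V : Finset X → ℝ} {c : ℝ} {s t : Finset X} (h : Flip s t) (hs : V s ≤ c)
    (ht : V t ≤ c) : Conn V c s t := Relation.ReflTransGen.single ⟨h, hs, ht⟩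

theorem Conn.le {V : Finset X → ℝ} {c : ℝ} {s t : Finset X} (h : Conn V c s t) (hs : V s ≤ c) :
    V t ≤ c := by
  induction h with
  | refl => exact hs
  | tail _ h _ => exact h.2.2

/-- The highest value on a path is attained, so a level can be lowered to a value of `V`. Minimal
levels can thus be sought among finitely many numbers. -/
theorem Conn.exists_eq {V : Finset X → ℝ} {c : ℝ} {s t : Finset X} (h : Conn V c s t)
    (hs : V s ≤ c) : ∃ z, V z ≤ c ∧ Conn V (V z) s t := by
  induction h with
  | refl => exact ⟨s, hs, .refl⟩
  | @tail a b _ h ih =>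
    obtain ⟨z, hz, hcz⟩ := ih
    have key : ∀ z', V z ≤ V z' → V a ≤ V z' → V b ≤ V z' → Conn V (V z') s b :=
      fun z' h1 h2 h3 => (hcz.mono h1).tail ⟨h.1, h2, h3⟩
    rcases le_total (V z) (V a) with h1 | h1 <;> rcases le_total (V a) (V b) with h2 | h2 <;>
      rcases le_total (V z) (V b) with h3 | h3
    all_goals first
      | exact ⟨b, h.2.2, key b (by linarith) (by linarith) le_rfl⟩
      | exact ⟨a, h.2.1, key a (by linarith) le_rfl (by linarith)⟩
      | exact ⟨z, hz, key z le_rfl (by linarith) (by linarith)⟩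

theorem Up.subset {V : Finset X → ℝ} {c : ℝ} {s t : Finset X} (h : Up V c s t) : s ⊆ t := by
  induction h with
  | refl => exact subset_rfl
  | tail _ h ih =>
    obtain ⟨⟨x, rfl⟩, -⟩ := h
    exact ih.trans (Finset.subset_insert _ _)

theorem Up.conn {V : Finset X → ℝ} {c : ℝ} {s t : Finset X} (h : Up V c s t) : Conn V c s t :=
  Relation.ReflTransGen.mono
    (fun _ _ h => ⟨by obtain ⟨⟨x, rfl⟩, -⟩ := h; exact flip_insert _ _, h.2⟩) _ _ h

theorem Up.exists_singleton {V : Finset X → ℝ} {c : ℝ} {t : Finset X} (h : Up V c ∅ t)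
    (ht : t.Nonempty) : ∃ x, Up V c {x} t ∧ V {x} ≤ c := by
  rcases Relation.ReflTransGen.cases_head h with rfl | ⟨s, ⟨⟨x, rfl⟩, h1⟩, h2⟩
  · simp at ht
  · exact ⟨x, h2, h1.2⟩

variable {V : Finset X → ℝ}

/-- Let `b` minimize `V` on the interval from `s` to `t` and intersect the growth with it. Since `V
(z ∪ b) ≥ V b`, submodularity gives `V (z ∩ b) ≤ V z`, so the truncated growth stays below `c`. -/
theorem Up.exists_between (hV : ∀ s t, V (s ∪ t) + V (s ∩ t) ≤ V s + V t)
    {c : ℝ} {s r t : Finset X} (h : Up V c r t) (hr : r ⊆ s)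
    (hst : s ⊆ t) (hrc : V r ≤ c) : ∃ b, s ⊆ b ∧ V b ≤ V s ∧ Up V c r b := by
  obtain ⟨b, hb, hmin⟩ := Finset.exists_min_image (Finset.Icc s t) V ⟨s, by simpa using hst⟩
  rw [Finset.mem_Icc] at hb
  have key : ∀ z, Up V c r z → z ⊆ t → Up V c r (z ∩ b) ∧ V (z ∩ b) ≤ c := by
    intro z hz hzt
    induction hz with
    | refl =>
      rw [Finset.inter_eq_left.2 (hr.trans hb.1)]
      exact ⟨.refl, hrc⟩
    | @tail a z _ h ih =>
      obtain ⟨⟨x, rfl⟩, -, h2⟩ := h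
      obtain ⟨h3, h4⟩ := ih ((Finset.subset_insert _ _).trans hzt)
      have h5 : V (insert x a ∩ b) ≤ c := by
        have h6 := hV (insert x a) b
        have h7 := hmin (insert x a ∪ b) (by
          rw [Finset.mem_Icc]
          exact ⟨hb.1.trans Finset.subset_union_right, Finset.union_subset hzt hb.2⟩)
        linarith
      by_cases hx : x ∈ b
      · rw [Finset.insert_inter_of_mem hx] at h5 ⊢
        exact ⟨h3.tail ⟨⟨x, rfl⟩, h4, h5⟩, h5⟩
      · rw [Finset.insert_inter_of_notMem hx] at h5 ⊢
        exact ⟨h3, h5⟩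
  refine ⟨b, hb.1, hmin s (by simpa using hst), ?_⟩
  have := (key t h subset_rfl).1
  rwa [Finset.inter_eq_right.2 hb.2] at this

/-- Anything reached from `∅` is dominated by a set reached from `∅` monotonically. -/
theorem Conn.exists_up (hV : ∀ s t, V (s ∪ t) + V (s ∩ t) ≤ V s + V t)
    {c : ℝ} (h0 : V ∅ ≤ c)
    {s : Finset X} (h : Conn V c ∅ s) : ∃ t, s ⊆ t ∧ V t ≤ V s ∧ Up V c ∅ t := by
  induction h with
  | refl => exact ⟨∅, subset_rfl, le_rfl, .refl⟩
  | @tail a b _ h ih =>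
    obtain ⟨t, hat, hVt, ht⟩ := ih
    obtain ⟨hf, ha, hb⟩ := h
    obtain ⟨x, rfl | rfl⟩ := hf.eq_or
    -- Adding `x` to `t` costs at most what it costs on the smaller set `a`, and `V t ≤ V a`.
    · have h1 : V (insert x t) ≤ c := by
        by_cases hx : x ∈ t
        · rw [Finset.insert_eq_of_mem hx]; linarith
        · have := hV t (insert x a)
          rw [Finset.union_insert, Finset.union_eq_left.2 hat, Finset.inter_insert_of_notMem hx,
            Finset.inter_eq_right.2 hat] at this
          linarith
      exact Up.exists_between hV (ht.tail ⟨⟨x, rfl⟩, hVt.trans ha, h1⟩) (by simp)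
        (Finset.insert_subset_insert _ hat) h0
    · exact Up.exists_between hV ht (by simp) ((Finset.erase_subset _ _).trans hat) h0

/-- A set of lower value is reached from `s` by a path that climbs by less than `c`. -/
def Progress (V : Finset X → ℝ) (c : ℝ) (s : Finset X) : Prop :=
  ∃ t, V t < V s ∧ ∃ c' < V s + c, Conn V c' s t

/-- Superpose the growth of `r` on `t`. As long as the unions do not drop below `V t`, submodularity
makes the traces on `t` a growth no more costly than the original one. The trace of `r` is then a
competitor of `r`, and minimality forces it to be `r`. -/
theorem subset_of_not_progress (hV : ∀ s t, V (s ∪ t) + V (s ∩ t) ≤ V s + V t)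
    {c : ℝ} (hc : 0 < c) {x : X} {r t : Finset X}
    (hr : Up V c {x} r) (hVr : V r ≤ 0)
    (hmin : ∀ s, Up V c {x} s → V s ≤ 0 → r.card ≤ s.card)
    (hxc : V {x} ≤ c) (hx : x ∈ t) (ht : ¬ Progress V c t) : r ⊆ t := by
  have key : ∀ s, Up V c {x} s → s.card ≤ r.card →
      Up V c {x} (t ∩ s) ∧ V (t ∩ s) ≤ c ∧ V (t ∩ s) ≤ V s ∧ ∃ c' < V t + c, V t ≤ c' ∧
        V (t ∪ s) ≤ c' ∧ Conn V c' t (t ∪ s) := by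
    intro s hs
    induction hs with
    | refl =>
      intro _
      rw [Finset.inter_singleton_of_mem hx,
        Finset.union_eq_left.2 (Finset.singleton_subset_iff.2 hx)]
      exact ⟨.refl, hxc, le_rfl, V t, by linarith, le_rfl, le_rfl, .refl⟩
    | @tail a b _ h ih =>
      obtain ⟨⟨y, rfl⟩, h1, h2⟩ := h
      intro hcard
      obtain ⟨i1, i2, i3, c', hc', hVc, i4, i5⟩ :=
        ih ((Finset.card_le_card (Finset.subset_insert _ _)).trans hcard)
      have hsub := hV t (insert y a)
      have hfl : Flip (t ∪ a) (t ∪ insert y a) := by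
        rw [Finset.union_insert]; exact flip_insert _ _
      have h3 : V t ≤ V (t ∪ insert y a) := by
        by_contra! h3
        exact ht ⟨_, h3, c', hc', i5.tail ⟨hfl, i4, h3.le.trans hVc⟩⟩
      have h4 : V (t ∩ insert y a) ≤ V (insert y a) := by linarith
      have h5 : Up V c {x} (t ∩ insert y a) := by
        have h6 := h4.trans h2
        by_cases hy : y ∈ t
        · rw [Finset.inter_insert_of_mem hy] at h6 ⊢
          exact i1.tail ⟨⟨y, rfl⟩, i2, h6⟩
        · rwa [Finset.inter_insert_of_notMem hy]
      refine ⟨h5, h4.trans h2, h4, ?_⟩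
      -- If the trace has nonpositive value, minimality and the bound on the cardinality make it the
      -- whole of `insert y a`, so the union is `t` itself. Otherwise its positive value makes the
      -- climb strictly less than `c`.
      by_cases h7 : V (t ∩ insert y a) ≤ 0
      · have h8 : t ∩ insert y a = insert y a :=
          Finset.eq_of_subset_of_card_le Finset.inter_subset_right (hcard.trans (hmin _ h5 h7))
        rw [Finset.union_eq_left.2 (Finset.inter_eq_right.1 h8)]
        exact ⟨V t, by linarith, le_rfl, le_rfl, .refl⟩
      · refine ⟨max c' (V (t ∪ insert y a)), max_lt hc' (by linarith), hVc.trans (le_max_left _ _),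
          le_max_right _ _, (i5.mono (le_max_left _ _)).tail
            ⟨hfl, i4.trans (le_max_left _ _), le_max_right _ _⟩⟩
  obtain ⟨h1, -, h3, -⟩ := key r hr le_rfl
  exact Finset.inter_eq_right.1 (Finset.eq_of_subset_of_card_le Finset.inter_subset_right
    (hmin _ h1 (h3.trans hVr)))

theorem Conn.map {c : ℝ} (T : Equiv.Perm X) (hT : ∀ s : Finset X, V (s.map T.toEmbedding) = V s)
    {s t : Finset X} (h : Conn V c s t) :
    Conn V c (s.map T.toEmbedding) (t.map T.toEmbedding) := by
  refine Relation.ReflTransGen.lift (fun s => Finset.map T.toEmbedding s) ?_ _ _ h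
  rintro a b ⟨⟨x, hx⟩, h1, h2⟩
  refine ⟨⟨T x, ?_⟩, by rwa [hT], by rwa [hT]⟩
  have := congrArg (Finset.map T.toEmbedding) hx
  rw [Finset.map_erase, Finset.map_erase] at this
  exact this

theorem Progress.map {c : ℝ} (T : Equiv.Perm X)
    (hT : ∀ s : Finset X, V (s.map T.toEmbedding) = V s)
    {s : Finset X} (h : Progress V c s) : Progress V c (s.map T.toEmbedding) := by
  obtain ⟨t, h1, c', h2, h3⟩ := h
  exact ⟨t.map T.toEmbedding, by rwa [hT, hT], c', by rwa [hT], h3.map T hT⟩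

/-- The energy landscape of a submodular function which is invariant under a group acting
transitively on the arcs of a connected graph, and additive over sets without edges between
them. -/
theorem exists_barrier [Fintype X] (hV : ∀ s t, V (s ∪ t) + V (s ∩ t) ≤ V s + V t)
    (adj : X → X → Prop) (h0 : V ∅ = 0) (h1 : ∀ x, 0 < V {x})
    (huniv : V Finset.univ < 0)
    (hadd : ∀ x s, x ∉ s → (∀ y ∈ s, ¬ adj x y) → V (insert x s) = V {x} + V s)
    (htrans : ∀ x y z w, adj x y → adj z w → ∃ T : Equiv.Perm X, T x = z ∧ T y = w ∧
      ∀ s : Finset X, V (s.map T.toEmbedding) = V s)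
    (hconn : ∀ s : Finset X, s.Nonempty → (∀ x ∈ s, ∀ y, adj x y → y ∈ s) → s = Finset.univ) :
    ∃ c > 0, (∀ c' < c, ∀ s, s.Nonempty → Conn V c' ∅ s → 0 < V s) ∧
      Conn V c ∅ Finset.univ ∧
      ∀ s, s.Nonempty → V s ≤ 0 → ∃ c' < V s + c, Conn V c' s Finset.univ := by
  classical
  have hne : (Finset.univ : Finset X).Nonempty := by
    rw [Finset.nonempty_iff_ne_empty]; intro h; rw [h, h0] at huniv; exact lt_irrefl _ huniv
  obtain ⟨M, hM⟩ : ∃ M : Finset X, ∀ s, V s ≤ V M := by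
    obtain ⟨M, -, hM⟩ := Finset.exists_max_image (Finset.univ : Finset (Finset X)) V ⟨∅, by simp⟩
    exact ⟨M, fun s => hM s (by simp)⟩
  have hall : ∀ s : Finset X, Conn V (V M) ∅ s := by
    intro s
    induction s using Finset.induction_on with
    | empty => exact .refl
    | insert x s _ ih => exact ih.tail ⟨flip_insert _ _, hM _, hM _⟩
  -- The barrier is the least level at which `∅` communicates with a nonempty set of nonpositive
  -- value. The clause `V ∅ ≤ V z` is what `Conn.exists_up` needs.
  obtain ⟨z, hz, hzmin⟩ := Finset.exists_min_image
    (Finset.univ.filter fun z : Finset X => ∃ r : Finset X, r.Nonempty ∧ V r ≤ 0 ∧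
      Conn V (V z) ∅ r ∧ V ∅ ≤ V z) V
    ⟨M, by simpa using ⟨Finset.univ, hne, huniv.le, hall _, hM ∅⟩⟩
  simp only [Finset.mem_filter, Finset.mem_univ, true_and] at hz hzmin
  set c := V z with hcdef
  obtain ⟨r₁, hr₁, hVr₁, hcr₁, h0c⟩ := hz
  obtain ⟨r₂, hr₂, hVr₂, hur₂⟩ := Conn.exists_up hV h0c hcr₁
  obtain ⟨x₂, hx₂, hx₂c⟩ := hur₂.exists_singleton (hr₁.mono hr₂)
  -- The minimum is taken over the starting point too, because deleting `x` below yields a growth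
  -- from another point.
  obtain ⟨⟨x, r⟩, hxr, hmin⟩ := Finset.exists_min_image
    (Finset.univ.filter fun q : X × Finset X => Up V c {q.1} q.2 ∧ V {q.1} ≤ c ∧ V q.2 ≤ 0)
    (fun q => q.2.card) ⟨(x₂, r₂), by simpa using ⟨hx₂, hx₂c, by linarith⟩⟩
  simp only [Finset.mem_filter, Finset.mem_univ, true_and, Prod.forall] at hxr hmin
  obtain ⟨hup, hxc, hVr⟩ := hxr
  have hc : 0 < c := (h1 x).trans_le hxc
  have hxr : x ∈ r := hup.subset (by simp)
  obtain ⟨y, hyr, hxy⟩ : ∃ y ∈ r, adj x y := by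
    by_contra! hno
    have hno' : ∀ s, s ⊆ r → x ∈ s → V s = V {x} + V (s.erase x) := by
      intro s hs hx
      conv_lhs => rw [← Finset.insert_erase hx]
      exact hadd x _ (by simp) fun y hy => hno y (hs (Finset.mem_of_mem_erase hy))
    -- Deleting an isolated `x` lowers each set of the growth by `V {x} > 0`. This gives a growth
    -- from `∅` to a smaller set of negative value, against minimality.
    have key : ∀ s, Up V c {x} s → s ⊆ r → Up V c ∅ (s.erase x) := by
      intro s hs
      induction hs with
      | refl => intro _; rw [Finset.erase_singleton]; exact .refl
      | @tail a b hab h ih =>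
        obtain ⟨⟨y, rfl⟩, h2, h3⟩ := h
        intro hr
        have hxa : x ∈ a := Up.subset hab (by simp)
        have har : a ⊆ r := (Finset.subset_insert _ _).trans hr
        have e1 := hno' _ har hxa
        have e2 := hno' _ hr (Finset.mem_insert_of_mem hxa)
        have hx1 := h1 x
        by_cases hyx : y = x
        · subst hyx
          rw [Finset.insert_eq_of_mem hxa]; exact ih har
        · rw [Finset.erase_insert_of_ne (Ne.symm fun h => hyx h.symm)] at e2 ⊢
          exact (ih har).tail ⟨⟨y, rfl⟩, by linarith, by linarith⟩
    have e := hno' r subset_rfl hxr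
    have hlt : V (r.erase x) < 0 := by linarith [h1 x]
    have hne' : (r.erase x).Nonempty := by
      rw [Finset.nonempty_iff_ne_empty]; intro h; rw [h, h0] at hlt; exact lt_irrefl _ hlt
    obtain ⟨x', hx', hx'c⟩ := (key r hup subset_rfl).exists_singleton hne'
    have := hmin x' (r.erase x) ⟨hx', hx'c, hlt.le⟩
    rw [Finset.card_erase_of_mem hxr] at this
    have := Finset.card_pos.2 ⟨x, hxr⟩
    omega
  -- For an arc from `z` in `s` to `w`, a symmetry carrying `(x, y)` to `(z, w)` pulls `s` back to a
  -- set that contains `x`, hence `r`, hence `y`; so `w` is in `s`.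
  have hprog : ∀ s : Finset X, s.Nonempty → s ≠ Finset.univ → Progress V c s := by
    intro s hs hsu
    by_contra hnp
    refine hsu (hconn s hs fun z hz w hzw => ?_)
    obtain ⟨T, hTx, hTy, hT⟩ := htrans x y z w hxy hzw
    have hT' : ∀ s : Finset X, V (s.map T.symm.toEmbedding) = V s := by
      intro s
      rw [← hT, Finset.map_map]
      congr 1
      ext; simp
    have hback : (s.map T.symm.toEmbedding).map T.toEmbedding = s := by
      rw [Finset.map_map]; ext; simp
    have := subset_of_not_progress hV hc hup hVr
      (fun t ht1 ht2 => hmin x t ⟨ht1, hxc, ht2⟩) hxc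
      (t := s.map T.symm.toEmbedding) (by simpa [hTx] using hz)
      (fun hp => hnp (by simpa only [hback] using hp.map T hT))
    have := this hyr
    simpa [hTy] using this
  -- A lowest set among those reachable below `V s + c` can only be `univ`: progress from any other
  -- would stay below the same level, and the lower set is nonempty as its value is negative.
  have hdown : ∀ s, s.Nonempty → V s ≤ 0 → ∃ c' < V s + c, Conn V c' s Finset.univ := by
    intro s hs hVs
    obtain ⟨t, ht, htmin⟩ := Finset.exists_min_image
      (Finset.univ.filter fun t : Finset X => t.Nonempty ∧ V t ≤ V s ∧
        ∃ c' < V s + c, Conn V c' s t) V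
      ⟨s, by simpa using ⟨hs, V s, by linarith, .refl⟩⟩
    simp only [Finset.mem_filter, Finset.mem_univ, true_and] at ht htmin
    obtain ⟨htn, hts, c', hc', hct⟩ := ht
    by_cases htu : t = Finset.univ
    · exact ⟨c', hc', htu ▸ hct⟩
    · obtain ⟨t', ht', c'', hc'', hct'⟩ := hprog t htn htu
      have := htmin t' ⟨?_, by linarith, max c' c'', max_lt hc' (by linarith),
        (hct.mono (le_max_left _ _)).trans (hct'.mono (le_max_right _ _))⟩
      · linarith
      · rw [Finset.nonempty_iff_ne_empty]; rintro rfl; linarith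
  refine ⟨c, hc, ?_, ?_, hdown⟩
  · intro c' hc' s hs hcs
    by_contra! hVs
    by_cases h0c' : V ∅ ≤ c'
    · obtain ⟨z', hz', hcz'⟩ := hcs.exists_eq h0c'
      by_cases h0z : V ∅ ≤ V z'
      · exact absurd (hzmin z' ⟨s, hs, hVs, hcz', h0z⟩) (by linarith)
      · rcases Relation.ReflTransGen.cases_head hcz' with rfl | ⟨_, ⟨_, h, _⟩, _⟩
        · simp at hs
        · exact h0z h
    · rcases Relation.ReflTransGen.cases_head hcs with rfl | ⟨_, ⟨_, h, _⟩, _⟩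
      · simp at hs
      · exact h0c' h
  · obtain ⟨c', hc', h⟩ := hdown r ⟨x, hxr⟩ hVr
    have hfirst : Conn V c ∅ {x} := Conn.step (by simpa using flip_insert x ∅) h0c hxc
    exact (hfirst.trans hup.conn).trans (h.mono (by linarith))

end Submodular

/-! ### Finite reversible chains: first entries and cuts -/

namespace FiniteChain

open Matrix

variable {A : Type*} [Fintype A] [DecidableEq A]

set_option linter.unusedSectionVars false

/-- The kernel `Q` killed on entering `S`. -/
def killed (Q : A → A → ℝ) (S : Finset A) : Matrix A A ℝ := fun a b => if b ∈ S then 0 else Q a b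

theorem killed_nonneg {Q : A → A → ℝ} (hQ : ∀ a b, 0 ≤ Q a b) (S : Finset A) (a b : A) :
    0 ≤ killed Q S a b := by
  unfold killed; split_ifs <;> simp [hQ]

theorem killed_le {Q : A → A → ℝ} (hQ : ∀ a b, 0 ≤ Q a b) (S : Finset A) (a b : A) :
    killed Q S a b ≤ Q a b := by
  unfold killed; split_ifs <;> simp [hQ]

theorem mulVec_nonneg {M : Matrix A A ℝ} (hM : ∀ a b, 0 ≤ M a b) {f : A → ℝ}
    (hf : ∀ a, 0 ≤ f a) (a : A) : 0 ≤ (M *ᵥ f) a :=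
  Finset.sum_nonneg fun b _ => mul_nonneg (hM a b) (hf b)

theorem pow_mulVec_succ (M : Matrix A A ℝ) (f : A → ℝ) (t : ℕ) :
    M ^ (t + 1) *ᵥ f = M *ᵥ (M ^ t *ᵥ f) := by
  rw [pow_succ', Matrix.mulVec_mulVec]

theorem pow_mulVec_nonneg {M : Matrix A A ℝ} (hM : ∀ a b, 0 ≤ M a b) {f : A → ℝ}
    (hf : ∀ a, 0 ≤ f a) (t : ℕ) (a : A) : 0 ≤ (M ^ t *ᵥ f) a := by
  induction t generalizing a with
  | zero => simpa using hf a
  | succ t ih => rw [pow_mulVec_succ]; exact mulVec_nonneg hM ih a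

theorem pow_entry_nonneg {M : Matrix A A ℝ} (hM : ∀ a b, 0 ≤ M a b) (t : ℕ) (a b : A) :
    0 ≤ (M ^ t) a b := by
  have := pow_mulVec_nonneg hM (f := Pi.single b 1)
    (fun c => by by_cases h : c = b <;> simp [h]) t a
  simpa using this

/-- The probability that the chain started at `a` enters `S` for the first time at time `t + 1`,
and does so at `p`. -/
def firstEntry (Q : A → A → ℝ) (S : Finset A) (p : A) (t : ℕ) : A → ℝ :=
  killed Q S ^ t *ᵥ fun a => Q a p

/-- The probability that the chain started at `a` is not at `m` at time `t + 1`, and has not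
visited `p` before. -/
def away (Q : A → A → ℝ) (m p : A) (t : ℕ) : A → ℝ :=
  killed Q {p} ^ t *ᵥ fun a => ∑ b, if b = m then 0 else Q a b

theorem firstEntry_succ (Q : A → A → ℝ) (S : Finset A) (p : A) (t : ℕ) (a : A) :
    firstEntry Q S p (t + 1) a = ∑ b, killed Q S a b * firstEntry Q S p t b := by
  unfold firstEntry; rw [pow_mulVec_succ]; rfl

theorem away_succ (Q : A → A → ℝ) (m p : A) (t : ℕ) (a : A) :
    away Q m p (t + 1) a = ∑ b, killed Q {p} a b * away Q m p t b := by
  unfold away; rw [pow_mulVec_succ]; rfl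

theorem firstEntry_zero (Q : A → A → ℝ) (S : Finset A) (p a : A) :
    firstEntry Q S p 0 a = Q a p := by simp [firstEntry]

theorem away_zero (Q : A → A → ℝ) (m p a : A) :
    away Q m p 0 a = ∑ b, if b = m then 0 else Q a b := by simp [away]

theorem firstEntry_nonneg {Q : A → A → ℝ} (hQ : ∀ a b, 0 ≤ Q a b) (S : Finset A) (p : A) (t : ℕ)
    (a : A) : 0 ≤ firstEntry Q S p t a :=
  pow_mulVec_nonneg (killed_nonneg hQ S) (fun _ => hQ _ _) t a

theorem away_nonneg {Q : A → A → ℝ} (hQ : ∀ a b, 0 ≤ Q a b) (m p : A) (t : ℕ) (a : A) :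
    0 ≤ away Q m p t a :=
  pow_mulVec_nonneg (killed_nonneg hQ _)
    (fun a => Finset.sum_nonneg fun b _ => by split_ifs <;> simp [hQ]) t a

/-- Decomposition at the last visit to `m`. -/
theorem firstEntry_le {Q : A → A → ℝ} (hQ : ∀ a b, 0 ≤ Q a b) (h1 : ∀ a, ∑ b, Q a b = 1)
    {m p : A} (hmp : m ≠ p) (t : ℕ) (a : A) :
    firstEntry Q {p} p t a ≤
      firstEntry Q {m, p} p t a + ∑ s ∈ Finset.range t, firstEntry Q {m, p} p s m := by
  induction t generalizing a with
  | zero => simp [firstEntry]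
  | succ t ih =>
    have hc : 0 ≤ ∑ s ∈ Finset.range (t + 1), firstEntry Q {m, p} p s m :=
      Finset.sum_nonneg fun s _ => firstEntry_nonneg hQ _ _ _ _
    set c := ∑ s ∈ Finset.range (t + 1), firstEntry Q {m, p} p s m with hcdef
    have hcs := Finset.sum_range_succ (fun s => firstEntry Q {m, p} p s m) t
    rw [firstEntry_succ, firstEntry_succ]
    calc ∑ b, killed Q {p} a b * firstEntry Q {p} p t b
        ≤ ∑ b, (killed Q {m, p} a b * firstEntry Q {m, p} p t b + Q a b * c) := by
          refine Finset.sum_le_sum fun b _ => ?_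
          by_cases hbp : b = p
          · simp only [killed, hbp, Finset.mem_singleton, Finset.mem_insert, or_true, if_true,
              zero_mul, zero_add]
            exact mul_nonneg (hQ _ _) hc
          · by_cases hbm : b = m
            · subst hbm
              simp only [killed, hbp, Finset.mem_singleton, Finset.mem_insert, true_or, if_true,
                zero_mul, zero_add, if_false]
              refine mul_le_mul_of_nonneg_left ((ih b).trans ?_) (hQ _ _)
              rw [hcdef, hcs]; linarith
            · simp only [killed, hbp, hbm, Finset.mem_singleton, Finset.mem_insert, or_self,
                if_false, ← mul_add]
              refine mul_le_mul_of_nonneg_left ((ih b).trans ?_) (hQ _ _)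
              have := firstEntry_nonneg hQ {m, p} p t m
              rw [hcdef, hcs]; linarith
      _ = _ := by
          rw [Finset.sum_add_distrib, ← Finset.sum_mul, h1, one_mul]

theorem sum_firstEntry_succ (Q : A → A → ℝ) (S : Finset A) (p : A) (N : ℕ) (a : A) :
    ∑ t ∈ Finset.range (N + 1), firstEntry Q S p t a =
      Q a p + ∑ b, killed Q S a b * ∑ t ∈ Finset.range N, firstEntry Q S p t b := by
  rw [Finset.sum_range_succ', firstEntry_zero, add_comm]
  congr 1
  simp_rw [firstEntry_succ, Finset.mul_sum]
  exact Finset.sum_comm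

theorem sum_firstEntry_le_one {Q : A → A → ℝ} (hQ : ∀ a b, 0 ≤ Q a b) (h1 : ∀ a, ∑ b, Q a b = 1)
    {S : Finset A} {p : A} (hp : p ∈ S) (N : ℕ) (a : A) :
    ∑ t ∈ Finset.range N, firstEntry Q S p t a ≤ 1 := by
  induction N generalizing a with
  | zero => simp
  | succ N ih =>
    rw [sum_firstEntry_succ, ← h1 a]
    calc Q a p + ∑ b, killed Q S a b * ∑ t ∈ Finset.range N, firstEntry Q S p t b
        ≤ (∑ b, if b = p then Q a b else 0) + ∑ b, (if b = p then 0 else Q a b) := by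
          refine add_le_add (by simp) (Finset.sum_le_sum fun b _ => ?_)
          by_cases hb : b = p
          · simp [killed, hb, hp]
          · rw [if_neg hb]
            exact (mul_le_of_le_one_right (killed_nonneg hQ _ _ _) (ih b)).trans (killed_le hQ _ _ _)
      _ = ∑ b, Q a b := by
          rw [← Finset.sum_add_distrib]
          exact Finset.sum_congr rfl fun b _ => by split_ifs <;> simp

/-- A function with values in `[0, 1]` which vanishes at `m` and is subharmonic on `D \ {m}` has
at `m` at most the flux of the unit function through the boundary of `D`. -/
theorem flux_le_cut {W : A → A → ℝ} (hW : ∀ a b, 0 ≤ W a b) (hsymm : ∀ a b, W a b = W b a)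
    {D : Finset A} {m : A} (hm : m ∈ D) {v : A → ℝ} (hv0 : ∀ a, 0 ≤ v a) (hv1 : ∀ a, v a ≤ 1)
    (hvm : v m = 0) (hv : ∀ a ∈ D, a ≠ m → (∑ b, W a b) * v a ≤ ∑ b, W a b * v b) :
    ∑ b, W m b * v b ≤ ∑ a ∈ D, ∑ b ∈ Dᶜ, W a b := by
  have e1 : ∑ a ∈ D, ∑ b ∈ D, W a b * (v b - v a) = 0 := by
    have h := Finset.sum_comm (s := D) (t := D) (f := fun a b => W a b * (v b - v a))
    have h2 : ∑ b ∈ D, ∑ a ∈ D, W a b * (v b - v a) = -∑ a ∈ D, ∑ b ∈ D, W a b * (v b - v a) := by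
      rw [← Finset.sum_neg_distrib]
      refine Finset.sum_congr rfl fun a _ => ?_
      rw [← Finset.sum_neg_distrib]
      exact Finset.sum_congr rfl fun b _ => by rw [hsymm b a]; ring
    linarith
  calc ∑ b, W m b * v b = ∑ b, W m b * (v b - v m) := by simp [hvm]
    -- All terms over `D` are nonnegative, by subharmonicity off `m` and by `v m = 0` at `m`. The
    -- contributions interior to `D` then cancel by antisymmetry (`e1`).
    _ ≤ ∑ a ∈ D, ∑ b, W a b * (v b - v a) := by
        refine Finset.single_le_sum (f := fun a => ∑ b, W a b * (v b - v a)) (fun a ha => ?_) hm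
        simp only [mul_sub, Finset.sum_sub_distrib, ← Finset.sum_mul]
        by_cases ham : a = m
        · subst ham
          simp only [hvm, mul_zero, sub_zero]
          exact Finset.sum_nonneg fun b _ => mul_nonneg (hW _ _) (hv0 _)
        · linarith [hv a ha ham]
    _ = ∑ a ∈ D, ∑ b ∈ D, W a b * (v b - v a) + ∑ a ∈ D, ∑ b ∈ Dᶜ, W a b * (v b - v a) := by
        rw [← Finset.sum_add_distrib]
        exact Finset.sum_congr rfl fun a _ => (Finset.sum_add_sum_compl D _).symm
    _ ≤ _ := by
        rw [e1, zero_add]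
        refine Finset.sum_le_sum fun a _ => Finset.sum_le_sum fun b _ => ?_
        exact mul_le_of_le_one_right (hW _ _) (by linarith [hv0 a, hv1 b])

/-- The function `v` is the probability of reaching `p` before `m` within `N` steps, with boundary
values 1 and 0. It grows with `N`, so the truncated version is subharmonic off `m` and `p`, which is
all `flux_le_cut` needs; no limit in `N` is taken. -/
theorem sum_firstEntry_le_cut {Q W : A → A → ℝ} (hQ : ∀ a b, 0 ≤ Q a b)
    (h1 : ∀ a, ∑ b, Q a b = 1) (hsymm : ∀ a b, W a b = W b a) {mu : A → ℝ} (hmu : ∀ a, 0 < mu a)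
    (hWQ : ∀ a b, mu a * Q a b = W a b) {D : Finset A} {m p : A} (hm : m ∈ D) (hp : p ∉ D)
    (N : ℕ) :
    ∑ t ∈ Finset.range N, firstEntry Q {m, p} p t m ≤ (∑ a ∈ D, ∑ b ∈ Dᶜ, W a b) / mu m := by
  have hmp : m ≠ p := ne_of_mem_of_not_mem hm hp
  have hW : ∀ a b, 0 ≤ W a b := fun a b => hWQ a b ▸ mul_nonneg (hmu a).le (hQ a b)
  have hsum : ∀ a, ∑ b, W a b = mu a := fun a => by
    simp_rw [← hWQ, ← Finset.mul_sum, h1, mul_one]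
  set vN : ℕ → A → ℝ := fun N a => ∑ t ∈ Finset.range N, firstEntry Q {m, p} p t a with hvN
  set v : A → ℝ := fun a => if a = p then 1 else if a = m then 0 else vN N a with hv
  have hstep : ∀ a, ∑ b, W a b * v b = mu a * vN (N + 1) a := by
    intro a
    rw [hvN]
    simp only
    rw [sum_firstEntry_succ, mul_add, Finset.mul_sum, hWQ]
    have : W a p = ∑ b, if b = p then W a b else 0 := by simp
    rw [this, ← Finset.sum_add_distrib]
    refine Finset.sum_congr rfl fun b _ => ?_
    rw [← mul_assoc]
    by_cases hbp : b = p
    · simp [hv, hbp, killed]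
    · by_cases hbm : b = m
      · simp [hv, hbm, hmp, killed]
      · simp [hv, hbp, hbm, killed, hWQ, hvN]
  have hle : ∀ a, vN N a ≤ vN (N + 1) a := fun a => by
    simp only [hvN, Finset.sum_range_succ]
    linarith [firstEntry_nonneg hQ {m, p} p N a]
  have hN0 : ∀ a, 0 ≤ vN N a := fun a => Finset.sum_nonneg fun t _ => firstEntry_nonneg hQ _ _ _ _
  have hN1 : ∀ a, vN N a ≤ 1 := fun a => sum_firstEntry_le_one hQ h1 (by simp) N a
  have := flux_le_cut hW hsymm hm (v := v)
    (fun a => by simp only [hv]; split_ifs <;> simp [hN0])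
    (fun a => by simp only [hv]; split_ifs <;> simp [hN1])
    (by simp [hv, hmp])
    (fun a ha ham => by
      rw [hstep, hsum]
      have hap : a ≠ p := fun h => hp (h ▸ ha)
      simp only [hv, hap, ham, if_false]
      exact mul_le_mul_of_nonneg_left (hle a) (hmu a).le)
  rw [hstep] at this
  rw [le_div_iff₀ (hmu m), mul_comm]
  exact (mul_le_mul_of_nonneg_left (hle m) (hmu m).le).trans this

theorem firstEntry_le_cut {Q W : A → A → ℝ} (hQ : ∀ a b, 0 ≤ Q a b)
    (h1 : ∀ a, ∑ b, Q a b = 1) (hsymm : ∀ a b, W a b = W b a) {mu : A → ℝ} (hmu : ∀ a, 0 < mu a)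
    (hWQ : ∀ a b, mu a * Q a b = W a b) {D : Finset A} {m p : A} (hm : m ∈ D) (hp : p ∉ D)
    (t : ℕ) : firstEntry Q {p} p t m ≤ (∑ a ∈ D, ∑ b ∈ Dᶜ, W a b) / mu m := by
  refine le_trans ?_ (sum_firstEntry_le_cut hQ h1 hsymm hmu hWQ hm hp (t + 1))
  rw [Finset.sum_range_succ, add_comm]
  exact firstEntry_le hQ h1 (ne_of_mem_of_not_mem hm hp) t m

/-! ### Bounds on the Green function -/

/-- The expected number of visits to `b` before time `N` and before the first visit to `p`, for
the chain started at `a`. -/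
def green (Q : A → A → ℝ) (p : A) (N : ℕ) (a b : A) : ℝ :=
  ∑ t ∈ Finset.range N, (killed Q {p} ^ t) a b

theorem green_succ (Q : A → A → ℝ) (p : A) (N : ℕ) (a b : A) :
    green Q p (N + 1) a b =
      (if a = b then 1 else 0) + ∑ c, killed Q {p} a c * green Q p N c b := by
  unfold green
  rw [Finset.sum_range_succ', add_comm]
  congr 1
  simp_rw [pow_succ', Matrix.mul_apply, Finset.mul_sum]
  exact Finset.sum_comm

theorem green_nonneg {Q : A → A → ℝ} (hQ : ∀ a b, 0 ≤ Q a b) (p : A) (N : ℕ) (a b : A) :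
    0 ≤ green Q p N a b :=
  Finset.sum_nonneg fun t _ => pow_entry_nonneg (killed_nonneg hQ _) t a b

theorem green_le_succ {Q : A → A → ℝ} (hQ : ∀ a b, 0 ≤ Q a b) (p : A) (N : ℕ) (a b : A) :
    green Q p N a b ≤ green Q p (N + 1) a b := by
  unfold green
  rw [Finset.sum_range_succ]
  linarith [pow_entry_nonneg (killed_nonneg hQ {p}) N a b]

/-- Maximum principle: visits to `b` are counted only from the first arrival at `b`. -/
theorem green_le_diag {Q : A → A → ℝ} (hQ : ∀ a b, 0 ≤ Q a b) (h1 : ∀ a, ∑ b, Q a b = 1) (p : A)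
    (N : ℕ) (a b : A) : green Q p N a b ≤ green Q p N b b := by
  induction N generalizing a with
  | zero => simp [green]
  | succ N ih =>
    by_cases hab : a = b
    · rw [hab]
    · refine le_trans ?_ (green_le_succ hQ p N b b)
      rw [green_succ, if_neg hab, zero_add]
      calc ∑ c, killed Q {p} a c * green Q p N c b ≤ ∑ c, Q a c * green Q p N b b :=
            Finset.sum_le_sum fun c _ => mul_le_mul (killed_le hQ _ _ _) (ih c)
              (green_nonneg hQ _ _ _ _) (hQ _ _)
        _ = _ := by rw [← Finset.sum_mul, h1, one_mul]

theorem killed_pow_reversible {Q W : A → A → ℝ} (hsymm : ∀ a b, W a b = W b a) {mu : A → ℝ}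
    (hWQ : ∀ a b, mu a * Q a b = W a b) {p a b : A} (ha : a ≠ p) (hb : b ≠ p) (t : ℕ) :
    mu a * (killed Q {p} ^ t) a b = mu b * (killed Q {p} ^ t) b a := by
  induction t generalizing a b with
  | zero =>
    by_cases h : a = b
    · rw [h]
    · simp [h, Ne.symm h]
  | succ t ih =>
    conv_lhs => rw [pow_succ', Matrix.mul_apply]
    conv_rhs => rw [pow_succ, Matrix.mul_apply]
    rw [Finset.mul_sum, Finset.mul_sum]
    refine Finset.sum_congr rfl fun c _ => ?_
    by_cases hc : c = p
    · subst hc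
      have : (killed Q {c} ^ t) b c * killed Q {c} c a = 0 := by
        cases t with
        | zero => simp [hb]
        | succ t =>
          rw [pow_succ, Matrix.mul_apply]
          simp [killed]
      rw [this]
      simp [killed]
    · have e := ih hc hb
      have e2 : mu a * killed Q {p} a c = mu c * killed Q {p} c a := by
        simp only [killed, Finset.mem_singleton, hc, ha, if_false]
        rw [hWQ, hWQ, hsymm]
      calc mu a * (killed Q {p} a c * (killed Q {p} ^ t) c b)
          = (mu a * killed Q {p} a c) * (killed Q {p} ^ t) c b := by ring
        _ = killed Q {p} c a * (mu c * (killed Q {p} ^ t) c b) := by rw [e2]; ring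
        _ = _ := by rw [e]; ring

theorem green_reversible {Q W : A → A → ℝ} (hsymm : ∀ a b, W a b = W b a) {mu : A → ℝ}
    (hWQ : ∀ a b, mu a * Q a b = W a b) {p a b : A} (ha : a ≠ p) (hb : b ≠ p) (N : ℕ) :
    mu a * green Q p N a b = mu b * green Q p N b a := by
  unfold green
  rw [Finset.mul_sum, Finset.mul_sum]
  exact Finset.sum_congr rfl fun t _ => killed_pow_reversible hsymm hWQ ha hb t

/-- Every function varies along a fixed path from `a` to `b` by at most `n` times its variation
along the edges. -/
def PathBound (r : A → A → Prop) (n : ℕ) (a b : A) : Prop :=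
  ∀ (w : A → ℝ) (s : ℝ), (∀ x y, r x y → |w x - w y| ≤ s) → |w a - w b| ≤ n * s

/-- The length `n` depends on the relation alone. With `r` defined by an energy level, it is uniform
in β. -/
theorem exists_pathBound {r : A → A → Prop} {a b : A} (h : Relation.ReflTransGen r a b) :
    ∃ n, PathBound r n a b := by
  induction h with
  | refl => exact ⟨0, fun w s _ => by simp⟩
  | @tail b c _ h ih =>
    obtain ⟨n, hn⟩ := ih
    refine ⟨n + 1, fun w s hs => ?_⟩
    have e1 := hn w s hs
    have e2 := hs b c h
    have := abs_sub_le (w a) (w b) (w c)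
    push_cast
    linarith

/-- Summation by parts turns the Dirichlet form into the pairing of `w` with its negative Laplacian,
to which only the source at `a` contributes positively. -/
theorem dirichlet_le {W : A → A → ℝ} (hsymm : ∀ a b, W a b = W b a)
    {a p : A} {w : A → ℝ} (hw0 : ∀ x, 0 ≤ w x) (hwp : w p = 0)
    (hw : ∀ x, x ≠ p → (∑ y, W x y) * w x ≤
      (if x = a then ∑ y, W x y else 0) + ∑ y, W x y * w y) :
    ∑ x, ∑ y, W x y * (w x - w y) ^ 2 ≤ 2 * ((∑ y, W a y) * w a) := by
  have e1 : ∑ x, ∑ y, W x y * (w x - w y) ^ 2 =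
      2 * ∑ x, w x * ((∑ y, W x y) * w x - ∑ y, W x y * w y) := by
    have h1 : ∑ x, ∑ y, W x y * (w x - w y) ^ 2 =
        ∑ x, ∑ y, w x * (W x y * w x - W x y * w y) +
          ∑ x, ∑ y, w y * (W y x * w y - W y x * w x) := by
      rw [← Finset.sum_add_distrib]
      refine Finset.sum_congr rfl fun x _ => ?_
      rw [← Finset.sum_add_distrib]
      exact Finset.sum_congr rfl fun y _ => by rw [hsymm y x]; ring
    rw [h1, Finset.sum_comm (f := fun x y => w y * (W y x * w y - W y x * w x)), ← two_mul]
    congr 1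
    refine Finset.sum_congr rfl fun x _ => ?_
    rw [← Finset.mul_sum, Finset.sum_sub_distrib, Finset.sum_mul]
  rw [e1]
  refine mul_le_mul_of_nonneg_left ?_ zero_le_two
  calc ∑ x, w x * ((∑ y, W x y) * w x - ∑ y, W x y * w y)
      ≤ ∑ x, (if x = a then (∑ y, W x y) * w x else 0) := by
        refine Finset.sum_le_sum fun x _ => ?_
        by_cases hx : x = p
        · subst hx
          simp [hwp]
        · have := mul_le_mul_of_nonneg_left (hw x hx) (hw0 x)
          split_ifs at this ⊢ <;> nlinarith
    _ = _ := by simp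

/-- Along the path from `a` to the zero at `p`, `w a` is at most `n` times the root of the Dirichlet
form over `k`. The form is at most linear in `w a`, so one factor `w a` cancels. -/
theorem le_of_dirichlet {W : A → A → ℝ} (hW : ∀ a b, 0 ≤ W a b) (hsymm : ∀ a b, W a b = W b a)
    {a p : A} {w : A → ℝ} (hw0 : ∀ x, 0 ≤ w x) (hwp : w p = 0)
    (hw : ∀ x, x ≠ p → (∑ y, W x y) * w x ≤
      (if x = a then ∑ y, W x y else 0) + ∑ y, W x y * w y)
    {r : A → A → Prop} {n : ℕ} (hr : PathBound r n a p) {k : ℝ} (hk : 0 < k)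
    (hrk : ∀ x y, r x y → k ≤ W x y) : w a ≤ 2 * n ^ 2 * (∑ y, W a y) / k := by
  have hd := dirichlet_le hsymm hw0 hwp hw
  set mu := ∑ y, W a y with hmu
  have hmu0 : 0 ≤ mu := Finset.sum_nonneg fun y _ => hW _ _
  have hE : 0 ≤ 2 * (mu * w a) / k := by have := hw0 a; positivity
  have hs : ∀ x y, r x y → |w x - w y| ≤ Real.sqrt (2 * (mu * w a) / k) := by
    intro x y hxy
    refine Real.abs_le_sqrt ?_
    rw [le_div_iff₀ hk]
    have h1 : W x y * (w x - w y) ^ 2 ≤ ∑ x, ∑ y, W x y * (w x - w y) ^ 2 := by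
      refine le_trans ?_ (Finset.single_le_sum (f := fun x => ∑ y, W x y * (w x - w y) ^ 2)
        (fun x _ => Finset.sum_nonneg fun y _ => mul_nonneg (hW _ _) (sq_nonneg _))
        (Finset.mem_univ x))
      exact Finset.single_le_sum (f := fun y => W x y * (w x - w y) ^ 2)
        (fun y _ => mul_nonneg (hW _ _) (sq_nonneg _)) (Finset.mem_univ y)
    have h2 : k * (w x - w y) ^ 2 ≤ W x y * (w x - w y) ^ 2 :=
      mul_le_mul_of_nonneg_right (hrk x y hxy) (sq_nonneg _)
    linarith
  have h3 := hr w _ hs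
  rw [hwp, sub_zero, abs_of_nonneg (hw0 a)] at h3
  have h4 : w a ^ 2 ≤ n ^ 2 * (2 * (mu * w a) / k) := by
    calc w a ^ 2 ≤ (n * Real.sqrt (2 * (mu * w a) / k)) ^ 2 := pow_le_pow_left₀ (hw0 a) h3 2
      _ = _ := by rw [mul_pow, Real.sq_sqrt hE]
  rcases (hw0 a).eq_or_lt with h5 | h5
  · rw [← h5]; positivity
  · refine le_of_mul_le_mul_right ?_ h5
    calc w a * w a = w a ^ 2 := by ring
      _ ≤ _ := h4
      _ = _ := by ring

theorem green_diag_le {Q W : A → A → ℝ} (hQ : ∀ a b, 0 ≤ Q a b)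
    (h1 : ∀ a, ∑ b, Q a b = 1) (hsymm : ∀ a b, W a b = W b a) {mu : A → ℝ} (hmu : ∀ a, 0 < mu a)
    (hWQ : ∀ a b, mu a * Q a b = W a b) {a p : A} (ha : a ≠ p)
    {r : A → A → Prop} {n : ℕ} (hr : PathBound r n a p) {k : ℝ} (hk : 0 < k)
    (hrk : ∀ x y, r x y → k ≤ W x y) (N : ℕ) : green Q p N a a ≤ 2 * n ^ 2 * mu a / k := by
  have hW : ∀ a b, 0 ≤ W a b := fun a b => hWQ a b ▸ mul_nonneg (hmu a).le (hQ a b)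
  have hsum : ∀ a, ∑ b, W a b = mu a := fun a => by
    simp_rw [← hWQ, ← Finset.mul_sum, h1, mul_one]
  have := le_of_dirichlet hW hsymm (a := a) (p := p)
    (w := fun x => if x = p then 0 else green Q p N x a)
    (fun x => by split_ifs <;> simp [green_nonneg hQ]) (by simp)
    (fun x hx => by
      simp only [hx, if_false, hsum]
      calc mu x * green Q p N x a ≤ mu x * green Q p (N + 1) x a :=
            mul_le_mul_of_nonneg_left (green_le_succ hQ p N x a) (hmu x).le
        _ = _ := by
            rw [green_succ, mul_add, Finset.mul_sum]
            congr 1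
            · simp
            · refine Finset.sum_congr rfl fun y _ => ?_
              by_cases hy : y = p
              · simp [killed, hy]
              · simp [killed, hy, ← hWQ, mul_assoc])
    hr hk hrk
  simpa [ha, hsum] using this

/-- A path from `m` serves as well as one from `a`: reversibility exchanges the arguments, trading
`mu m` for `mu a`. -/
theorem green_le_of_pathBound {Q W : A → A → ℝ} (hQ : ∀ a b, 0 ≤ Q a b)
    (h1 : ∀ a, ∑ b, Q a b = 1) (hsymm : ∀ a b, W a b = W b a) {mu : A → ℝ} (hmu : ∀ a, 0 < mu a)
    (hWQ : ∀ a b, mu a * Q a b = W a b) {a m p : A} (ha : a ≠ p) (hm : m ≠ p)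
    {r : A → A → Prop} {n : ℕ} (hr : PathBound r n a p ∨ PathBound r n m p) {k : ℝ} (hk : 0 < k)
    (hrk : ∀ x y, r x y → k ≤ W x y) (N : ℕ) : green Q p N m a ≤ 2 * n ^ 2 * mu a / k := by
  rcases hr with hr | hr
  · exact (green_le_diag hQ h1 p N m a).trans (green_diag_le hQ h1 hsymm hmu hWQ ha hr hk hrk N)
  · have e1 := green_reversible hsymm hWQ hm ha N
    have e2 := (green_le_diag hQ h1 p N a m).trans
      (green_diag_le hQ h1 hsymm hmu hWQ hm hr hk hrk N)
    refine le_of_mul_le_mul_left ?_ (hmu m)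
    rw [e1]
    refine (mul_le_mul_of_nonneg_left e2 (hmu a).le).trans_eq ?_
    ring

theorem away_eq (Q : A → A → ℝ) {m p : A} (hmp : m ≠ p) (t : ℕ) (a : A) :
    away Q m p t a = ∑ b ∈ ({m, p} : Finset A)ᶜ, (killed Q {p} ^ (t + 1)) a b +
      firstEntry Q {p} p t a := by
  have h : ∀ x, (∑ b, if b = m then 0 else Q x b) =
      ∑ b ∈ ({m, p} : Finset A)ᶜ, killed Q {p} x b + Q x p := by
    intro x
    rw [← Finset.sum_subset (Finset.subset_univ ({m} : Finset A)ᶜ) (by simp)]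
    have hp : p ∈ ({m} : Finset A)ᶜ := by simp [hmp.symm]
    rw [← Finset.sum_erase_add _ _ hp]
    have : (({m} : Finset A)ᶜ).erase p = ({m, p} : Finset A)ᶜ := by
      ext y; simp [and_comm]
    rw [this]
    simp only [hmp.symm, if_false]
    congr 1
    refine Finset.sum_congr rfl fun b hb => ?_
    simp only [Finset.mem_compl, Finset.mem_insert, Finset.mem_singleton, not_or] at hb
    simp [killed, hb]
  unfold away firstEntry Matrix.mulVec dotProduct
  simp_rw [h, mul_add, Finset.sum_add_distrib, pow_succ, Matrix.mul_apply, Finset.mul_sum]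
  rw [Finset.sum_comm]

/-! ### Two independent copies -/

/-- For two independent copies of the chain, a bound for the probability that `p` is reached by
one of them within `N` steps, while the other is not at `m`. -/
def pairBound (Q : A → A → ℝ) (m p : A) (N : ℕ) (a b : A) : ℝ :=
  ∑ t ∈ Finset.range N, (firstEntry Q {p} p t a * away Q m p t b +
    away Q m p t a * firstEntry Q {p} p t b)

theorem pairBound_comm (Q : A → A → ℝ) (m p : A) (N : ℕ) (a b : A) :
    pairBound Q m p N a b = pairBound Q m p N b a :=
  Finset.sum_congr rfl fun _ _ => by ring

theorem pairBound_nonneg {Q : A → A → ℝ} (hQ : ∀ a b, 0 ≤ Q a b) (m p : A) (N : ℕ) (a b : A) :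
    0 ≤ pairBound Q m p N a b :=
  Finset.sum_nonneg fun _ _ => add_nonneg
    (mul_nonneg (firstEntry_nonneg hQ _ _ _ _) (away_nonneg hQ _ _ _ _))
    (mul_nonneg (away_nonneg hQ _ _ _ _) (firstEntry_nonneg hQ _ _ _ _))

theorem pairBound_succ (Q : A → A → ℝ) (m p : A) (N : ℕ) (a b : A) :
    pairBound Q m p (N + 1) a b =
      Q a p * (∑ y, if y = m then 0 else Q b y) + (∑ x, if x = m then 0 else Q a x) * Q b p +
      ∑ x, ∑ y, killed Q {p} a x * killed Q {p} b y * pairBound Q m p N x y := by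
  unfold pairBound
  rw [Finset.sum_range_succ', add_comm]
  congr 1
  · simp [firstEntry_zero, away_zero]
  · simp_rw [firstEntry_succ, away_succ, Finset.sum_mul_sum, Finset.mul_sum]
    rw [Finset.sum_congr rfl fun x _ => Finset.sum_comm, Finset.sum_comm]
    refine Finset.sum_congr rfl fun t _ => ?_
    rw [← Finset.sum_add_distrib]
    refine Finset.sum_congr rfl fun x _ => ?_
    rw [← Finset.sum_add_distrib]
    exact Finset.sum_congr rfl fun y _ => by ring

/-- The one-step recursion for the race: pay 1 when one copy is at `p` with the other off `m`, pay
nothing at `(p, m)` and `(m, p)`, and continue when neither is at `p`. -/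
theorem sum_le_pairBound_succ {Q : A → A → ℝ} (hQ : ∀ a b, 0 ≤ Q a b) {m p : A} (N : ℕ)
    {F : A → A → ℝ} (hF : ∀ x y, F x y ≤
      (if x = p ∧ y ≠ m then 1 else 0) + (if x ≠ m ∧ y = p then 1 else 0) +
        (if x ≠ p ∧ y ≠ p then pairBound Q m p N x y else 0)) (a b : A) :
    ∑ x, ∑ y, Q a x * Q b y * F x y ≤ pairBound Q m p (N + 1) a b := by
  rw [pairBound_succ]
  have e1 : Q a p * (∑ y, if y = m then 0 else Q b y) =
      ∑ x, ∑ y, Q a x * Q b y * (if x = p ∧ y ≠ m then 1 else 0) := by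
    rw [Finset.sum_eq_single (M := ℝ) (s := Finset.univ) (f := fun x => ∑ y, Q a x * Q b y *
      (if x = p ∧ y ≠ m then 1 else 0)) p (fun x _ hx => by simp [hx]) (by simp), Finset.mul_sum]
    exact Finset.sum_congr rfl fun y _ => by by_cases h : y = m <;> simp [h]
  have e2 : (∑ x, if x = m then 0 else Q a x) * Q b p =
      ∑ x, ∑ y, Q a x * Q b y * (if x ≠ m ∧ y = p then 1 else 0) := by
    rw [Finset.sum_mul]
    refine Finset.sum_congr rfl fun x _ => ?_
    rw [Finset.sum_eq_single p (fun x _ hx => by simp [hx]) (by simp)]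
    by_cases h : x = m <;> simp [h]
  have e3 : ∑ x, ∑ y, killed Q {p} a x * killed Q {p} b y * pairBound Q m p N x y =
      ∑ x, ∑ y, Q a x * Q b y * (if x ≠ p ∧ y ≠ p then pairBound Q m p N x y else 0) := by
    refine Finset.sum_congr rfl fun x _ => Finset.sum_congr rfl fun y _ => ?_
    by_cases hx : x = p <;> by_cases hy : y = p <;> simp [killed, hx, hy]
  rw [e1, e2, e3, ← Finset.sum_add_distrib, ← Finset.sum_add_distrib]
  refine Finset.sum_le_sum fun x _ => ?_
  rw [← Finset.sum_add_distrib, ← Finset.sum_add_distrib]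
  refine Finset.sum_le_sum fun y _ => ?_
  rw [← mul_add, ← mul_add]
  exact mul_le_mul_of_nonneg_left (hF x y) (mul_nonneg (hQ _ _) (hQ _ _))

/-- Once `q` is factored out, the times off `m` add up to the occupation of the other states, plus
at most 1 for the arrival at `p`. -/
theorem pairBound_le {Q : A → A → ℝ} (hQ : ∀ a b, 0 ≤ Q a b) (h1 : ∀ a, ∑ b, Q a b = 1) {m p : A}
    (hmp : m ≠ p) {q : ℝ} (hq : ∀ t, firstEntry Q {p} p t m ≤ q) (N : ℕ) :
    pairBound Q m p N m m ≤
      2 * q * (∑ a ∈ ({m, p} : Finset A)ᶜ, green Q p (N + 1) m a + 1) := by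
  have hq0 : 0 ≤ q := (firstEntry_nonneg hQ _ _ _ _).trans (hq 0)
  calc pairBound Q m p N m m ≤ ∑ t ∈ Finset.range N, 2 * q * away Q m p t m := by
        refine Finset.sum_le_sum fun t _ => ?_
        have := mul_le_mul_of_nonneg_right (hq t) (away_nonneg hQ m p t m)
        linarith
    _ = 2 * q * ∑ t ∈ Finset.range N, away Q m p t m := by rw [Finset.mul_sum]
    _ ≤ _ := by
        refine mul_le_mul_of_nonneg_left ?_ (by linarith)
        simp_rw [away_eq Q hmp]
        rw [Finset.sum_add_distrib]
        refine add_le_add ?_ (sum_firstEntry_le_one hQ h1 (by simp) N m)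
        rw [Finset.sum_comm]
        refine Finset.sum_le_sum fun a _ => ?_
        unfold green
        rw [Finset.sum_range_succ']
        linarith [pow_entry_nonneg (killed_nonneg hQ {p}) 0 m a]

end FiniteChain

/-! ### The Ising energy on the torus -/

namespace PCA

/-- The unit vectors of the torus. -/
def IsUnitVec {L : ℕ} (z : Site L) : Prop :=
  z = (1, 0) ∨ z = (-1, 0) ∨ z = (0, 1) ∨ z = (0, -1)

theorem two_le {L : ℕ} [NeZero L] (hL : Even L) : 2 ≤ L := by
  obtain ⟨k, hk⟩ := hL
  have := NeZero.ne L
  omega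

theorem natAbs_valMinAbs_one {L : ℕ} (hL : 2 ≤ L) : (1 : ZMod L).valMinAbs.natAbs = 1 := by
  have : NeZero L := ⟨by omega⟩
  have : Fact (1 < L) := ⟨by omega⟩
  rw [ZMod.valMinAbs_natAbs_eq_min, ZMod.val_one]
  omega

theorem sq_valMinAbs {L : ℕ} (a : ZMod L) : a.valMinAbs ^ 2 = (a.valMinAbs.natAbs : ℤ) ^ 2 := by
  rw [Int.natAbs_sq]

theorem torusLength_eq_one_iff {L : ℕ} [NeZero L] (hL : 2 ≤ L) (z : Site L) :
    torusLength z = 1 ↔ IsUnitVec z := by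
  have e : torusLength z = 1 ↔ z.1.valMinAbs ^ 2 + z.2.valMinAbs ^ 2 = 1 := by
    unfold torusLength
    rw [Real.sqrt_eq_one]
    exact_mod_cast Iff.rfl
  rw [e]
  constructor
  · intro h
    have hz1 := ZMod.coe_valMinAbs z.1
    have hz2 := ZMod.coe_valMinAbs z.2
    generalize z.1.valMinAbs = m at *
    generalize z.2.valMinAbs = n at *
    have hm : m ≤ 1 := by nlinarith
    have hm' : -1 ≤ m := by nlinarith
    have hn : n ≤ 1 := by nlinarith
    have hn' : -1 ≤ n := by nlinarith
    unfold IsUnitVec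
    simp only [Prod.ext_iff, ← hz1, ← hz2]
    interval_cases m <;> interval_cases n <;> simp_all
  · have h1 : (1 : ZMod L).valMinAbs ^ 2 = 1 := by
      rw [sq_valMinAbs, natAbs_valMinAbs_one hL]; rfl
    have h2 : (-1 : ZMod L).valMinAbs ^ 2 = 1 := by
      rw [sq_valMinAbs, ZMod.natAbs_valMinAbs_neg, natAbs_valMinAbs_one hL]; rfl
    rintro (rfl | rfl | rfl | rfl) <;> simp [h1, h2]

theorem K_neg {L : ℕ} [NeZero L] (z : Site L) : K (-z) = K z := by
  have : torusLength (-z) = torusLength z := by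
    have h : ∀ a : ZMod L, ((-a).valMinAbs : ℝ) ^ 2 = (a.valMinAbs : ℝ) ^ 2 := fun a => by
      have := sq_valMinAbs (-a)
      rw [ZMod.natAbs_valMinAbs_neg, ← sq_valMinAbs] at this
      exact_mod_cast this
    simp only [torusLength, Prod.fst_neg, Prod.snd_neg, h]
  unfold K; rw [this]

theorem K_sub_comm {L : ℕ} [NeZero L] (x y : Site L) : K (x - y) = K (y - x) := by
  rw [← K_neg, neg_sub]

theorem K_swap {L : ℕ} (z : Site L) : K z.swap = K z := by
  have : torusLength z.swap = torusLength z := by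
    unfold torusLength; rw [Prod.fst_swap, Prod.snd_swap, add_comm]
  unfold K; rw [this]

theorem K_nonneg {L : ℕ} (z : Site L) : 0 ≤ K z := by
  unfold K; split_ifs <;> norm_num

theorem K_eq_one_iff {L : ℕ} [NeZero L] (hL : 2 ≤ L) (z : Site L) : K z = 1 ↔ IsUnitVec z := by
  rw [← torusLength_eq_one_iff hL]
  unfold K; split_ifs with h <;> simp [h]

theorem K_eq_zero_or_one {L : ℕ} (z : Site L) : K z = 0 ∨ K z = 1 := by
  unfold K; split_ifs <;> simp

theorem K_zero (L : ℕ) : K (0 : Site L) = 0 := by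
  simp [K, torusLength]

/-- The number of neighbors of a site. -/
noncomputable def deg (L : ℕ) [NeZero L] : ℝ := ∑ z : Site L, K z

theorem one_le_deg {L : ℕ} [NeZero L] (hL : 2 ≤ L) : 1 ≤ deg L := by
  rw [← (K_eq_one_iff hL (1, 0)).2 (Or.inl rfl)]
  exact Finset.single_le_sum (f := fun z : Site L => K z) (fun z _ => K_nonneg z)
    (Finset.mem_univ _)

theorem sum_K_sub {L : ℕ} [NeZero L] (x : Site L) : ∑ y : Site L, K (x - y) = deg L :=
  Fintype.sum_equiv (Equiv.subLeft x) _ _ fun _ => rfl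

/-- Half the excess Ising energy, with respect to `d`, of the configuration whose plus spins form
the set `s`. -/
noncomputable def energy {L : ℕ} [NeZero L] (h : ℝ) (s : Finset (Site L)) : ℝ :=
  (deg L - h) * s.card - ∑ x ∈ s, ∑ y ∈ s, K (x - y)

theorem energy_eq {L : ℕ} [NeZero L] (h : ℝ) (s : Finset (Site L)) :
    energy h s = (deg L - h) * (∑ x, if x ∈ s then 1 else 0) -
      ∑ x, ∑ y, K (x - y) * ((if x ∈ s then 1 else 0) * (if y ∈ s then 1 else 0)) := by
  unfold energy
  congr 1
  · simp
  · have h2 : ∀ x : Site L, ∑ y ∈ s, K (x - y) = ∑ y, K (x - y) * (if y ∈ s then 1 else 0) := by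
      intro x; simp
    simp_rw [h2]
    rw [← Finset.sum_subset (Finset.subset_univ s) (by intro x _ hx; simp [hx])]
    exact Finset.sum_congr rfl fun x hx => Finset.sum_congr rfl fun y _ => by simp [hx]


theorem energy_empty {L : ℕ} [NeZero L] (h : ℝ) : energy h (∅ : Finset (Site L)) = 0 := by
  simp [energy]

theorem energy_univ {L : ℕ} [NeZero L] {h : ℝ} (hh : 0 < h) :
    energy h (Finset.univ : Finset (Site L)) < 0 := by
  unfold energy
  simp_rw [sum_K_sub, Finset.sum_const, nsmul_eq_mul]
  have : (0 : ℝ) < (Finset.univ : Finset (Site L)).card := by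
    exact_mod_cast Finset.card_pos.2 ⟨0, Finset.mem_univ _⟩
  nlinarith

theorem energy_singleton {L : ℕ} [NeZero L] (h : ℝ) (x : Site L) :
    energy h {x} = deg L - h := by
  simp [energy, K_zero]

/-- Cardinality is modular, and the indicator that both ends of a pair lie in a set is supermodular;
it enters with the sign of an attractive interaction, `K ≥ 0`. -/
theorem energy_union_add_inter {L : ℕ} [NeZero L] (h : ℝ) (s t : Finset (Site L)) :
    energy h (s ∪ t) + energy h (s ∩ t) ≤ energy h s + energy h t := by
  have hc : ((s ∪ t).card : ℝ) + (s ∩ t).card = s.card + t.card := by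
    exact_mod_cast Finset.card_union_add_card_inter s t
  have hJ : ∀ r : Finset (Site L), energy h r = (deg L - h) * r.card -
      ∑ x, ∑ y, K (x - y) * ((if x ∈ r then 1 else 0) * (if y ∈ r then 1 else 0)) := fun r => by
    simp [energy_eq]
  have key : (∑ x, ∑ y, K (x - y) * ((if x ∈ s then 1 else 0) * (if y ∈ s then 1 else 0))) +
      (∑ x, ∑ y, K (x - y) * ((if x ∈ t then 1 else 0) * (if y ∈ t then 1 else 0))) ≤
      (∑ x, ∑ y, K (x - y) * ((if x ∈ s ∪ t then 1 else 0) * (if y ∈ s ∪ t then 1 else 0))) +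
      (∑ x, ∑ y, K (x - y) * ((if x ∈ s ∩ t then 1 else 0) * (if y ∈ s ∩ t then 1 else 0))) := by
    simp_rw [← Finset.sum_add_distrib, ← mul_add]
    refine Finset.sum_le_sum fun x _ => Finset.sum_le_sum fun y _ =>
      mul_le_mul_of_nonneg_left ?_ (K_nonneg _)
    by_cases h1 : x ∈ s <;> by_cases h2 : x ∈ t <;> by_cases h3 : y ∈ s <;>
      by_cases h4 : y ∈ t <;> simp [h1, h2, h3, h4]
  rw [hJ (s ∪ t), hJ (s ∩ t), hJ s, hJ t]
  have := congrArg (fun r => (deg L - h) * r) hc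
  simp only [mul_add] at this
  linarith

theorem energy_insert {L : ℕ} [NeZero L] (h : ℝ) {x : Site L} {s : Finset (Site L)} (hx : x ∉ s)
    (hs : ∀ y ∈ s, ¬ K (x - y) = 1) : energy h (insert x s) = energy h {x} + energy h s := by
  have h0 : ∀ y ∈ s, K (x - y) = 0 := fun y hy => (K_eq_zero_or_one _).resolve_right (hs y hy)
  have h1 : ∑ y ∈ s, K (x - y) = 0 := Finset.sum_eq_zero h0
  have h2 : ∑ y ∈ s, K (y - x) = 0 :=
    Finset.sum_eq_zero fun y hy => by rw [K_sub_comm]; exact h0 y hy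
  rw [energy_singleton]
  unfold energy
  rw [Finset.card_insert_of_notMem hx, Finset.sum_insert hx]
  simp_rw [Finset.sum_insert hx, Finset.sum_add_distrib]
  rw [h1, h2, sub_self, K_zero]
  push_cast
  ring

theorem energy_map {L : ℕ} [NeZero L] (h : ℝ) (T : Equiv.Perm (Site L))
    (hT : ∀ x y, K (T x - T y) = K (x - y)) (s : Finset (Site L)) :
    energy h (s.map T.toEmbedding) = energy h s := by
  simp [energy, hT]

/-- Up to sign, two unit vectors agree or differ by the swap of coordinates; negation settles the
sign. -/
theorem exists_addEquiv {L : ℕ} [NeZero L] {e e' : Site L} (he : IsUnitVec e)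
    (he' : IsUnitVec e') : ∃ M : Site L ≃+ Site L, M e = e' ∧ ∀ z, K (M z) = K z := by
  have key : (∃ M : Site L ≃+ Site L, M e = e' ∧ (∀ z, K (M z) = K z)) ∨
      ∃ M : Site L ≃+ Site L, M e = -e' ∧ (∀ z, K (M z) = K z) := by
    rcases he with rfl | rfl | rfl | rfl <;> rcases he' with rfl | rfl | rfl | rfl
    all_goals first
      | exact Or.inl ⟨AddEquiv.refl _, rfl, fun z => rfl⟩
      | exact Or.inl ⟨AddEquiv.prodComm, rfl, fun z => K_swap z⟩
      | (refine Or.inr ⟨AddEquiv.refl _, ?_, fun z => rfl⟩; simp; done)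
      | (refine Or.inr ⟨AddEquiv.prodComm, ?_, fun z => K_swap z⟩; simp)
  rcases key with h | ⟨M, h1, h2⟩
  · exact h
  · exact ⟨M.trans (AddEquiv.neg _), by simp [h1], fun z => by simp [K_neg, h2]⟩

theorem exists_perm {L : ℕ} [NeZero L] (hL : 2 ≤ L) {x y z w : Site L} (hxy : K (x - y) = 1)
    (hzw : K (z - w) = 1) : ∃ T : Equiv.Perm (Site L), T x = z ∧ T y = w ∧
      ∀ a b, K (T a - T b) = K (a - b) := by
  rw [K_eq_one_iff hL] at hxy hzw
  obtain ⟨M, h1, h2⟩ := exists_addEquiv hxy hzw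
  refine ⟨(Equiv.subRight x).trans (M.toEquiv.trans (Equiv.addRight z)), by simp, ?_, fun a b => ?_⟩
  · have : M (y - x) = w - z := by rw [← neg_sub x y, map_neg, h1, neg_sub]
    simp [this]
  · simp only [Equiv.trans_apply, Equiv.subRight_apply, AddEquiv.toEquiv_eq_coe, EquivLike.coe_coe,
      Equiv.coe_addRight, add_sub_add_right_eq_sub]
    rw [← map_sub, h2, sub_sub_sub_cancel_right]

theorem eq_univ_of_closed {L : ℕ} [NeZero L] (hL : 2 ≤ L) {s : Finset (Site L)} (hs : s.Nonempty)
    (h : ∀ x ∈ s, ∀ y, K (x - y) = 1 → y ∈ s) : s = Finset.univ := by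
  obtain ⟨⟨a, b⟩, hab⟩ := hs
  have h1 : ∀ n : ℕ, (a + n, b) ∈ s := by
    intro n
    induction n with
    | zero => simpa using hab
    | succ n ih =>
      refine h _ ih _ ((K_eq_one_iff hL _).2 (Or.inr (Or.inl ?_)))
      ext <;> simp
  have h2 : ∀ m n : ℕ, (a + m, b + n) ∈ s := by
    intro m n
    induction n with
    | zero => simpa using h1 m
    | succ n ih =>
      refine h _ ih _ ((K_eq_one_iff hL _).2 (Or.inr (Or.inr (Or.inr ?_))))
      ext <;> simp
  ext ⟨x, y⟩
  simp only [Finset.mem_univ, iff_true]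
  have := h2 (x - a).val (y - b).val
  simpa using this

/-- The energy landscape of the Ising model on the torus. -/
theorem exists_energy_barrier {L : ℕ} [NeZero L] (hL : 2 ≤ L) {h : ℝ} (h0 : 0 < h) (h1 : h < 1) :
    ∃ c > 0, (∀ c' < c, ∀ s : Finset (Site L), s.Nonempty →
        Submodular.Conn (energy h) c' ∅ s → 0 < energy h s) ∧
      Submodular.Conn (energy h) c ∅ (Finset.univ : Finset (Site L)) ∧
      ∀ s : Finset (Site L), s.Nonempty → energy h s ≤ 0 →
        ∃ c' < energy h s + c, Submodular.Conn (energy h) c' s Finset.univ := by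
  refine Submodular.exists_barrier (energy_union_add_inter h) (fun x y => K (x - y) = 1)
    (energy_empty h) (fun x => ?_) (energy_univ h0) (fun x s => energy_insert h)
    (fun x y z w hxy hzw => ?_) (fun s => eq_univ_of_closed hL)
  · rw [energy_singleton]; linarith [one_le_deg hL]
  · obtain ⟨T, hTx, hTy, hT⟩ := exists_perm hL hxy hzw
    exact ⟨T, hTx, hTy, energy_map h T hT⟩

end PCA

/-! ### Splitting into sublattices and reversibility of the half chain -/

namespace PCA

open Submodular

/-- The sites of even parity. -/
abbrev EvenSite (L : ℕ) : Type := {x : Site L // Even (x.1.val + x.2.val)}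

/-- The configurations on the even sublattice. -/
abbrev Half (L : ℕ) : Type := EvenSite L → ℤˣ

/-- A reflection of the torus that exchanges the even and the odd sublattice. -/
def reflect (L : ℕ) : Equiv.Perm (Site L) := Equiv.subLeft (1, 0)

section Parity

variable {L : ℕ} [NeZero L]

theorem even_val_add (hL : Even L) (a b : ZMod L) : Even (a + b).val ↔ (Even a.val ↔ Even b.val) := by
  rw [ZMod.val_add, Nat.even_iff, Nat.mod_mod_of_dvd _ hL.two_dvd, ← Nat.even_iff, Nat.even_add]

theorem even_site_add (hL : Even L) (x y : Site L) :
    Even ((x + y).1.val + (x + y).2.val) ↔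
      (Even (x.1.val + x.2.val) ↔ Even (y.1.val + y.2.val)) := by
  simp only [Prod.fst_add, Prod.snd_add, Nat.even_add, even_val_add hL]
  tauto

theorem even_site_sub (hL : Even L) (x y : Site L) :
    Even ((x - y).1.val + (x - y).2.val) ↔
      (Even (x.1.val + x.2.val) ↔ Even (y.1.val + y.2.val)) := by
  have := even_site_add hL (x - y) y
  rw [sub_add_cancel] at this
  tauto

theorem not_even_unitVec (hL : Even L) {z : Site L} (hz : IsUnitVec z) :
    ¬ Even (z.1.val + z.2.val) := by
  have h2 := two_le hL
  have : Fact (1 < L) := ⟨by omega⟩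
  have h1 : ¬ Even (-1 : ZMod L).val := by
    have := even_val_add hL (-1) (1 : ZMod L)
    simp only [neg_add_cancel, ZMod.val_zero, Even.zero, ZMod.val_one, Nat.not_even_one,
      iff_false, true_iff] at this
    exact this
  rcases hz with rfl | rfl | rfl | rfl <;> simp [ZMod.val_one, h1]

theorem reflect_apply {L : ℕ} (x : Site L) : reflect L x = (1, 0) - x := rfl

theorem reflect_reflect {L : ℕ} (x : Site L) : reflect L (reflect L x) = x := by
  simp [reflect_apply]

theorem even_reflect (hL : Even L) (x : Site L) :
    Even ((reflect L x).1.val + (reflect L x).2.val) ↔ ¬ Even (x.1.val + x.2.val) := by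
  rw [reflect_apply, even_site_sub hL]
  have := not_even_unitVec hL (z := ((1, 0) : Site L)) (Or.inl rfl)
  tauto

theorem K_reflect (x y : Site L) : K (reflect L x - reflect L y) = K (x - y) := by
  rw [reflect_apply, reflect_apply, sub_sub_sub_cancel_left, K_sub_comm]

theorem K_eq_zero_of_parity (hL : Even L) {x y : Site L}
    (h : Even (x.1.val + x.2.val) ↔ Even (y.1.val + y.2.val)) : K (x - y) = 0 :=
  (K_eq_zero_or_one _).resolve_right fun h1 =>
    not_even_unitVec hL ((K_eq_one_iff (two_le hL) _).1 h1) ((even_site_sub hL x y).2 h)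

theorem bijective_sites (hL : Even L) :
    Function.Bijective (Sum.elim (fun y : EvenSite L => y.1) fun y : EvenSite L => reflect L y.1) := by
  constructor
  · rintro (x | x) (y | y) h
    · exact congrArg _ (Subtype.ext h)
    · exact absurd ((congrArg (fun z : Site L => Even (z.1.val + z.2.val)) h).mp x.2)
        (fun h' => (even_reflect hL y.1).1 h' y.2)
    · exact absurd ((congrArg (fun z : Site L => Even (z.1.val + z.2.val)) h).mpr y.2)
        (fun h' => (even_reflect hL x.1).1 h' x.2)
    · exact congrArg _ (Subtype.ext ((reflect L).injective h))
  · intro x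
    by_cases hx : Even (x.1.val + x.2.val)
    · exact ⟨Sum.inl ⟨x, hx⟩, rfl⟩
    · exact ⟨Sum.inr ⟨reflect L x, (even_reflect hL x).2 hx⟩, reflect_reflect x⟩

/-- The torus as two copies of the even sublattice. -/
noncomputable def siteEquiv (hL : Even L) : EvenSite L ⊕ EvenSite L ≃ Site L :=
  Equiv.ofBijective _ (bijective_sites hL)

theorem siteEquiv_inl (hL : Even L) (y : EvenSite L) : siteEquiv hL (Sum.inl y) = y.1 := rfl

theorem siteEquiv_inr (hL : Even L) (y : EvenSite L) :
    siteEquiv hL (Sum.inr y) = reflect L y.1 := rfl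

theorem sum_sites (hL : Even L) (f : Site L → ℝ) :
    ∑ x, f x = ∑ y : EvenSite L, f y.1 + ∑ y : EvenSite L, f (reflect L y.1) := by
  rw [← (siteEquiv hL).sum_comp, Fintype.sum_sum_type]; rfl

theorem prod_sites (hL : Even L) (f : Site L → ℝ) :
    ∏ x, f x = (∏ y : EvenSite L, f y.1) * ∏ y : EvenSite L, f (reflect L y.1) := by
  rw [← (siteEquiv hL).prod_comp, Fintype.prod_sum_type]; rfl

/-- A configuration as a pair of configurations on the even sublattice. -/
noncomputable def configEquiv (hL : Even L) : Half L × Half L ≃ Config L :=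
  (Equiv.sumArrowEquivProdArrow _ _ _).symm.trans
    (Equiv.arrowCongr (siteEquiv hL) (Equiv.refl _))

theorem configEquiv_even (hL : Even L) (q : Half L × Half L) (y : EvenSite L) :
    configEquiv hL q y.1 = q.1 y := by
  have : (siteEquiv hL).symm y.1 = Sum.inl y := by
    rw [Equiv.symm_apply_eq]; rfl
  simp [configEquiv, Equiv.arrowCongr, this, Equiv.sumArrowEquivProdArrow]

theorem configEquiv_odd (hL : Even L) (q : Half L × Half L) (y : EvenSite L) :
    configEquiv hL q (reflect L y.1) = q.2 y := by
  have : (siteEquiv hL).symm (reflect L y.1) = Sum.inr y := by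
    rw [Equiv.symm_apply_eq]; rfl
  simp [configEquiv, Equiv.arrowCongr, this, Equiv.sumArrowEquivProdArrow]

theorem eq_configEquiv_iff (hL : Even L) (σ : Config L) (q : Half L × Half L) :
    σ = configEquiv hL q ↔
      (∀ y : EvenSite L, σ y.1 = q.1 y) ∧ ∀ y : EvenSite L, σ (reflect L y.1) = q.2 y := by
  constructor
  · rintro rfl
    exact ⟨configEquiv_even hL q, configEquiv_odd hL q⟩
  · rintro ⟨h1, h2⟩
    funext x
    obtain ⟨y | y, rfl⟩ := (siteEquiv hL).surjective x
    · rw [siteEquiv_inl, h1, configEquiv_even]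
    · rw [siteEquiv_inr, h2, configEquiv_odd]

theorem u_eq (hL : Even L) : u L = configEquiv hL (1, 1) :=
  (eq_configEquiv_iff hL _ _).2 ⟨fun _ => rfl, fun _ => rfl⟩

theorem d_eq (hL : Even L) : d L = configEquiv hL (-1, -1) :=
  (eq_configEquiv_iff hL _ _).2 ⟨fun _ => rfl, fun _ => rfl⟩

theorem ce_eq (hL : Even L) : ce L = configEquiv hL (1, -1) := by
  refine (eq_configEquiv_iff hL _ _).2 ⟨fun y => y.2.neg_one_pow, fun y => Odd.neg_one_pow ?_⟩
  rw [← Nat.not_even_iff_odd, even_reflect hL, not_not]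
  exact y.2

theorem co_eq (hL : Even L) : co L = configEquiv hL (-1, 1) := by
  refine (eq_configEquiv_iff hL _ _).2
    ⟨fun y => (Even.add_one y.2).neg_one_pow, fun y => Even.neg_one_pow ?_⟩
  rw [Nat.even_add_one, even_reflect hL, not_not]
  exact y.2

/-- The field at an even site created by the spins of the other sublattice. -/
noncomputable def field (a : Half L) (y : EvenSite L) : ℝ :=
  ∑ x : EvenSite L, K (y.1 - reflect L x.1) * ((a x : ℤ) : ℝ)

theorem S_even (hL : Even L) (q : Half L × Half L) (y : EvenSite L) :
    S (configEquiv hL q) y.1 = field q.2 y := by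
  unfold S field
  rw [sum_sites hL, Finset.sum_eq_zero, zero_add]
  · simp_rw [configEquiv_odd]
  · intro x _
    rw [K_eq_zero_of_parity hL (iff_of_true y.2 x.2), zero_mul]

/-- The folding map is an isometric involution, so the coupling between the two halves is a
symmetric matrix. This is the source of reversibility. -/
theorem K_reflect_left (x y : Site L) : K (reflect L x - y) = K (x - reflect L y) := by
  rw [← K_reflect x, reflect_reflect]

theorem S_odd (hL : Even L) (q : Half L × Half L) (y : EvenSite L) :
    S (configEquiv hL q) (reflect L y.1) = field q.1 y := by
  unfold S field
  rw [sum_sites hL, add_comm, Finset.sum_eq_zero, zero_add]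
  · simp_rw [configEquiv_even, K_reflect_left]
  · intro x _
    rw [K_reflect, K_eq_zero_of_parity hL (iff_of_true y.2 x.2), zero_mul]

/-- The transition matrix of the chain on the even sublattice. -/
noncomputable def halfKernel (β h : ℝ) (a b : Half L) : ℝ :=
  ∏ y, 1 / (1 + Real.exp (-2 * β * ((b y : ℤ) : ℝ) * (field a y + h)))

theorem p_configEquiv (hL : Even L) (β h : ℝ) (q r : Half L × Half L) :
    p β h (configEquiv hL q) (configEquiv hL r) =
      halfKernel β h q.2 r.1 * halfKernel β h q.1 r.2 := by
  unfold p
  rw [prod_sites hL]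
  simp_rw [siteProb, S_even, S_odd, configEquiv_even, configEquiv_odd]
  rfl

theorem halfKernel_nonneg (β h : ℝ) (a b : Half L) : 0 ≤ halfKernel β h a b :=
  Finset.prod_nonneg fun y _ => by positivity

/-- The Gibbs form of the update: its denominator does not depend on the new spin and cancels
against the product in `halfMeasure`. -/
theorem one_div_add_exp (s : ℤˣ) (t : ℝ) : 1 / (1 + Real.exp (-2 * ((s : ℤ) : ℝ) * t)) =
    Real.exp (2 * ((if s = 1 then 1 else 0) * t)) / (1 + Real.exp (2 * t)) := by
  rcases Int.units_eq_one_or s with rfl | rfl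
  · have : -2 * ((1 : ℤˣ) : ℤ) * t = -(2 * t) := by push_cast; ring
    rw [this, Real.exp_neg, if_pos rfl, one_mul]
    have := Real.exp_pos (2 * t)
    field_simp
    ring
  · have h1 : (-1 : ℤˣ) ≠ 1 := by decide
    have : -2 * ((-1 : ℤˣ) : ℤ) * t = 2 * t := by push_cast; ring
    rw [this, if_neg h1]
    simp

theorem sum_halfKernel (β h : ℝ) (a : Half L) : ∑ b, halfKernel β h a b = 1 := by
  unfold halfKernel
  rw [← Fintype.piFinset_univ, ← Finset.prod_univ_sum (fun _ : EvenSite L => Finset.univ)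
    (fun y (s : ℤˣ) => 1 / (1 + Real.exp (-2 * β * ((s : ℤ) : ℝ) * (field a y + h))))]
  refine Finset.prod_eq_one fun y _ => ?_
  have hu : (Finset.univ : Finset ℤˣ) = {1, -1} := by decide
  rw [hu, Finset.sum_pair (by decide)]
  have e : ∀ s : ℤˣ, -2 * β * ((s : ℤ) : ℝ) * (field a y + h) =
    -2 * ((s : ℤ) : ℝ) * (β * (field a y + h)) := fun s => by ring
  have h1 : (-1 : ℤˣ) ≠ 1 := by decide
  simp_rw [e, one_div_add_exp, if_pos, if_neg h1]
  have := Real.exp_pos (2 * (β * (field a y + h)))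
  simp only [zero_mul, mul_zero, Real.exp_zero, one_mul]
  field_simp
  ring

/-- The set of the plus spins of the configuration on the torus composed of two configurations
on the even sublattice. -/
noncomputable def plusSet (hL : Even L) (a b : Half L) : Finset (Site L) :=
  Finset.univ.filter fun x => configEquiv hL (a, b) x = 1

/-- The part of the energy that depends on the even sublattice only. -/
noncomputable def selfEnergy (h : ℝ) (a : Half L) : ℝ :=
  (deg L - h) * ∑ y, if a y = 1 then 1 else 0

theorem field_eq (hL : Even L) (a : Half L) (y : EvenSite L) : field a y =
    2 * (∑ x : EvenSite L, K (y.1 - reflect L x.1) * (if a x = 1 then 1 else 0)) - deg L := by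
  have hd : deg L = ∑ x : EvenSite L, K (y.1 - reflect L x.1) := by
    rw [← sum_K_sub y.1, sum_sites hL, Finset.sum_eq_zero, zero_add]
    exact fun x _ => K_eq_zero_of_parity hL (iff_of_true y.2 x.2)
  rw [hd, Finset.mul_sum, ← Finset.sum_sub_distrib]
  refine Finset.sum_congr rfl fun x _ => ?_
  have h1 : (-1 : ℤˣ) ≠ 1 := by decide
  rcases Int.units_eq_one_or (a x) with h | h <;> rw [h] <;> simp [h1]
  ring

/-- Sites of equal parity do not interact, so for fixed `a` the energy is a sum of independent
contributions of the spins of `b`. -/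
theorem energy_plusSet (hL : Even L) (h : ℝ) (a b : Half L) : energy h (plusSet hL a b) =
    selfEnergy h a - ∑ y, (if b y = 1 then 1 else 0) * (field a y + h) := by
  have hK : ∀ x y : EvenSite L, K (x.1 - y.1) = 0 := fun x y =>
    K_eq_zero_of_parity hL (iff_of_true x.2 y.2)
  have hcomm : ∀ x y : EvenSite L, K (x.1 - reflect L y.1) = K (y.1 - reflect L x.1) := fun x y => by
    rw [← K_reflect_left, K_sub_comm]
  rw [energy_eq]
  simp only [plusSet, Finset.mem_filter, Finset.mem_univ, true_and]
  simp_rw [sum_sites hL, configEquiv_even, configEquiv_odd, K_reflect, K_reflect_left, hK]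
  simp only [zero_mul, Finset.sum_const_zero, zero_add, add_zero]
  simp_rw [field_eq hL a, selfEnergy]
  have e : ∑ x : EvenSite L, ∑ y : EvenSite L, K (x.1 - reflect L y.1) *
      ((if a x = 1 then (1 : ℝ) else 0) * (if b y = 1 then 1 else 0)) =
      ∑ y : EvenSite L, (if b y = 1 then 1 else 0) *
        ∑ x : EvenSite L, K (y.1 - reflect L x.1) * (if a x = 1 then 1 else 0) := by
    rw [Finset.sum_comm]
    refine Finset.sum_congr rfl fun y _ => ?_
    rw [Finset.mul_sum]
    exact Finset.sum_congr rfl fun x _ => by rw [hcomm]; ring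
  have e' : ∑ x : EvenSite L, ∑ y : EvenSite L, K (x.1 - reflect L y.1) *
      ((if b x = 1 then (1 : ℝ) else 0) * (if a y = 1 then 1 else 0)) =
      ∑ y : EvenSite L, (if b y = 1 then 1 else 0) *
        ∑ x : EvenSite L, K (y.1 - reflect L x.1) * (if a x = 1 then 1 else 0) := by
    refine Finset.sum_congr rfl fun y _ => ?_
    rw [Finset.mul_sum]
    exact Finset.sum_congr rfl fun x _ => by ring
  rw [e, e', mul_add, Finset.mul_sum (f := fun y => if b y = 1 then (1 : ℝ) else 0),
    ← Finset.sum_add_distrib]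
  have : ∀ P A B : ℝ, A + P - B = A - (B - P) := fun P A B => by ring
  rw [this, ← Finset.sum_sub_distrib]
  congr 1
  exact Finset.sum_congr rfl fun y _ => by ring

theorem map_reflect_plusSet (hL : Even L) (a b : Half L) :
    (plusSet hL a b).map (reflect L).toEmbedding = plusSet hL b a := by
  have key : ∀ x, configEquiv hL (b, a) (reflect L x) = configEquiv hL (a, b) x := by
    intro x
    obtain ⟨y | y, rfl⟩ := (siteEquiv hL).surjective x
    · rw [siteEquiv_inl, configEquiv_odd, configEquiv_even]
    · rw [siteEquiv_inr, reflect_reflect, configEquiv_odd, configEquiv_even]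
  ext x
  rw [← reflect_reflect x]
  rw [show reflect L (reflect L x) = (reflect L).toEmbedding (reflect L x) from rfl,
    Finset.mem_map' (reflect L).toEmbedding]
  simp only [plusSet, Finset.mem_filter, Finset.mem_univ, true_and, Equiv.coe_toEmbedding, key]

theorem energy_plusSet_comm (hL : Even L) (h : ℝ) (a b : Half L) :
    energy h (plusSet hL a b) = energy h (plusSet hL b a) := by
  rw [← map_reflect_plusSet hL a b, energy_map h _ K_reflect]

/-- The symmetric weight with respect to which the chain on the even sublattice is reversible. -/
noncomputable def weight (hL : Even L) (β h : ℝ) (a b : Half L) : ℝ :=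
  Real.exp (-2 * β * energy h (plusSet hL a b))

/-- The reversible measure of the chain on the even sublattice. -/
noncomputable def halfMeasure (β h : ℝ) (a : Half L) : ℝ :=
  Real.exp (-2 * β * selfEnergy h a) * ∏ y, (1 + Real.exp (2 * (β * (field a y + h))))

theorem halfMeasure_pos (β h : ℝ) (a : Half L) : 0 < halfMeasure β h a :=
  mul_pos (Real.exp_pos _) (Finset.prod_pos fun y _ => by positivity)

theorem halfMeasure_mul_halfKernel (hL : Even L) (β h : ℝ) (a b : Half L) :
    halfMeasure β h a * halfKernel β h a b = weight hL β h a b := by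
  unfold halfMeasure halfKernel weight
  have e : ∀ y, -2 * β * ((b y : ℤ) : ℝ) * (field a y + h) =
    -2 * ((b y : ℤ) : ℝ) * (β * (field a y + h)) := fun s => by ring
  simp_rw [e, one_div_add_exp]
  rw [Finset.prod_div_distrib, mul_assoc, mul_div_cancel₀, ← Real.exp_sum, ← Real.exp_add,
    energy_plusSet, mul_sub, Finset.mul_sum, sub_eq_add_neg, ← Finset.sum_neg_distrib]
  · congr 2
    exact Finset.sum_congr rfl fun y _ => by ring
  · exact (Finset.prod_pos fun y _ => by positivity).ne'

theorem weight_comm (hL : Even L) (β h : ℝ) (a b : Half L) :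
    weight hL β h a b = weight hL β h b a := by
  unfold weight; rw [energy_plusSet_comm]

theorem sum_weight (hL : Even L) (β h : ℝ) (a : Half L) :
    ∑ b, weight hL β h a b = halfMeasure β h a := by
  simp_rw [← halfMeasure_mul_halfKernel hL, ← Finset.mul_sum, sum_halfKernel, mul_one]

theorem exists_plusSet_eq (hL : Even L) (s : Finset (Site L)) :
    ∃ a b, s = plusSet hL a b := by
  obtain ⟨⟨a, b⟩, hab⟩ := (configEquiv hL).surjective fun x => if x ∈ s then 1 else -1
  refine ⟨a, b, ?_⟩
  have h1 : (-1 : ℤˣ) ≠ 1 := by decide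
  ext x
  simp [plusSet, hab, h1]

theorem mem_plusSet_even (hL : Even L) (a b : Half L) (y : EvenSite L) :
    y.1 ∈ plusSet hL a b ↔ a y = 1 := by
  simp [plusSet, configEquiv_even]

theorem mem_plusSet_odd (hL : Even L) (a b : Half L) (y : EvenSite L) :
    reflect L y.1 ∈ plusSet hL a b ↔ b y = 1 := by
  simp [plusSet, configEquiv_odd]

theorem units_eq_of_iff {s t : ℤˣ} (h : s = 1 ↔ t = 1) : s = t := by
  rcases Int.units_eq_one_or s with rfl | rfl <;> rcases Int.units_eq_one_or t with rfl | rfl <;>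
    simp_all

theorem eq_or_eq_of_flip (hL : Even L) {a b a' b' : Half L}
    (h : Flip (plusSet hL a b) (plusSet hL a' b')) : a = a' ∨ b = b' := by
  obtain ⟨x, hx⟩ := h
  have key : ∀ z, z ≠ x → (z ∈ plusSet hL a b ↔ z ∈ plusSet hL a' b') := by
    intro z hz
    have := congrArg (z ∈ ·) hx
    simpa [hz] using this
  by_cases he : Even (x.1.val + x.2.val)
  · right
    funext y
    refine units_eq_of_iff ?_
    rw [← mem_plusSet_odd hL a b, ← mem_plusSet_odd hL a' b']
    exact key _ fun h => (even_reflect hL y.1).1 (h ▸ he) y.2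
  · left
    funext y
    refine units_eq_of_iff ?_
    rw [← mem_plusSet_even hL a b, ← mem_plusSet_even hL a' b']
    exact key _ fun h => he (h ▸ y.2)

theorem flip_update (hL : Even L) (a b : Half L) (y : EvenSite L) (s : ℤˣ) :
    Flip (plusSet hL a b) (plusSet hL a (Function.update b y s)) := by
  refine ⟨reflect L y.1, ?_⟩
  ext x
  simp only [Finset.mem_erase]
  refine and_congr_right fun hx => ?_
  obtain ⟨z | z, rfl⟩ := (siteEquiv hL).surjective x
  · rw [siteEquiv_inl, mem_plusSet_even, mem_plusSet_even]
  · rw [siteEquiv_inr] at hx ⊢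
    have hzy : z ≠ y := fun h => hx (by rw [h])
    rw [mem_plusSet_odd, mem_plusSet_odd, Function.update_of_ne hzy]

/-- The configuration on one sublattice that minimizes the energy given the other one. -/
noncomputable def relax (h : ℝ) (a : Half L) : Half L := fun y => if 0 ≤ field a y + h then 1 else -1

/-- For fixed `a` the spins of `b` decouple, so they can be aligned with their fields one by one
without ever raising the energy. -/
theorem conn_relax (hL : Even L) {h c : ℝ} {a b : Half L} (hc : energy h (plusSet hL a b) ≤ c) :
    Conn (energy h) c (plusSet hL a b) (plusSet hL a (relax h a)) := by
  have h1 : (-1 : ℤˣ) ≠ 1 := by decide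
  have hle : ∀ (b : Half L) (y : EvenSite L),
      energy h (plusSet hL a (Function.update b y (relax h a y))) ≤ energy h (plusSet hL a b) := by
    intro b y
    rw [energy_plusSet, energy_plusSet]
    refine sub_le_sub_left (Finset.sum_le_sum fun z _ => ?_) _
    by_cases hz : z = y
    · subst hz
      rw [Function.update_self, relax]
      split_ifs <;> simp_all; linarith
    · rw [Function.update_of_ne hz]
  have key : ∀ T : Finset (EvenSite L),
      Conn (energy h) c (plusSet hL a b) (plusSet hL a (T.piecewise (relax h a) b)) ∧
        energy h (plusSet hL a (T.piecewise (relax h a) b)) ≤ c := by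
    intro T
    induction T using Finset.induction_on with
    | empty => rw [Finset.piecewise_empty]; exact ⟨.refl, hc⟩
    | insert y T _ ih =>
      rw [Finset.piecewise_insert]
      exact ⟨ih.1.tail ⟨flip_update hL _ _ _ _, ih.2, (hle _ _).trans ih.2⟩, (hle _ _).trans ih.2⟩
  have := (key Finset.univ).1
  rwa [Finset.piecewise_univ] at this

theorem conn_of_left_eq (hL : Even L) {h c : ℝ} {a b b' : Half L}
    (hc : energy h (plusSet hL a b) ≤ c) (hc' : energy h (plusSet hL a b') ≤ c) :
    Conn (energy h) c (plusSet hL a b) (plusSet hL a b') :=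
  (conn_relax hL hc).trans (conn_relax hL hc').symm

/-- A flip changes only one half, and each visited configuration is itself an edge between its two
halves. Both halves must be followed, since the half chain alternates between them. -/
theorem reach_of_conn (hL : Even L) {h c : ℝ} {a b : Half L} {s : Finset (Site L)}
    (hc : energy h (plusSet hL a b) ≤ c) (hs : Conn (energy h) c (plusSet hL a b) s) :
    ∀ a' b', s = plusSet hL a' b' →
      Relation.ReflTransGen (fun x y => energy h (plusSet hL x y) ≤ c) a a' ∧
        Relation.ReflTransGen (fun x y => energy h (plusSet hL x y) ≤ c) a b' := by
  have hinj : ∀ a b a' b', plusSet hL a b = plusSet hL a' b' → a = a' ∧ b = b' := by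
    intro a b a' b' h
    exact ⟨funext fun y => units_eq_of_iff (by
      rw [← mem_plusSet_even hL a b, h, mem_plusSet_even]), funext fun y => units_eq_of_iff (by
      rw [← mem_plusSet_odd hL a b, h, mem_plusSet_odd])⟩
  induction hs with
  | refl =>
    intro a' b' h
    obtain ⟨rfl, rfl⟩ := hinj _ _ _ _ h
    exact ⟨.refl, .single hc⟩
  | @tail s t _ hst ih =>
    rintro a' b' rfl
    obtain ⟨a₁, b₁, rfl⟩ := exists_plusSet_eq hL s
    obtain ⟨i1, i2⟩ := ih a₁ b₁ rfl
    obtain ⟨hf, h1, h2⟩ := hst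
    rcases eq_or_eq_of_flip hL hf with rfl | rfl
    · exact ⟨i1, i1.tail h2⟩
    · exact ⟨i2.tail (by rwa [energy_plusSet_comm]), i2⟩

theorem plusSet_one (hL : Even L) : plusSet hL 1 1 = Finset.univ := by
  ext x
  have := congrFun (u_eq hL) x
  simp [plusSet, ← this, u]

theorem plusSet_neg_one (hL : Even L) : plusSet hL (-1) (-1) = ∅ := by
  ext x
  have := congrFun (d_eq hL) x
  simp [plusSet, ← this, d]

end Parity

end PCA

/-! ### Low-temperature estimates -/

namespace PCA

open Submodular FiniteChain

section Asymptotics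

variable {L : ℕ} [NeZero L]

theorem one_ne_neg_one (L : ℕ) [NeZero L] : (-1 : Half L) ≠ 1 := by
  intro h
  have := congrFun h ⟨0, by simp⟩
  exact absurd this (by simp)

theorem halfMeasure_le (hL : Even L) (h : ℝ) (a : Half L) :
    ∃ b, ∀ β > 0, halfMeasure β h a ≤
      Fintype.card (Half L) * Real.exp (-2 * β * energy h (plusSet hL a b)) := by
  obtain ⟨b, -, hb⟩ := Finset.exists_min_image Finset.univ
    (fun b => energy h (plusSet hL a b)) ⟨1, Finset.mem_univ (1 : Half L)⟩
  refine ⟨b, fun β hβ => ?_⟩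
  rw [← sum_weight hL, Fintype.card, ← nsmul_eq_mul]
  refine Finset.sum_le_card_nsmul _ _ _ fun b' _ => Real.exp_le_exp.2 ?_
  have := hb b' (Finset.mem_univ _)
  nlinarith

/-- With `b` the best partner of `a`, the measure of `a` is at most a constant times exp(-2βE). A
path of height `c' < E + c` leaves the exponent `2 * (E + c - c')`. -/
theorem exists_green_le (hL : Even L) {h c : ℝ} (hc : 0 < c)
    (hcu : Conn (energy h) c ∅ (Finset.univ : Finset (Site L)))
    (hdown : ∀ s : Finset (Site L), s.Nonempty → energy h s ≤ 0 →
        ∃ c' < energy h s + c, Conn (energy h) c' s Finset.univ)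
    {a : Half L} (ha : a ≠ 1) (ha' : a ≠ -1) :
    ∃ C ≥ 0, ∃ ε > 0, ∀ β > 0, ∀ N,
      Real.exp (-2 * β * c) * green (halfKernel β h) 1 N (-1) a ≤ C * Real.exp (-β * ε) := by
  obtain ⟨b, hb⟩ := halfMeasure_le hL h a
  set E := energy h (plusSet hL a b) with hE
  obtain ⟨c', hc', n, hn⟩ : ∃ c' < E + c, ∃ n,
      PathBound (fun x y => energy h (plusSet hL x y) ≤ c') n a 1 ∨
      PathBound (fun x y => energy h (plusSet hL x y) ≤ c') n (-1) 1 := by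
    rcases le_or_gt E 0 with hE0 | hE0
    · have hne : (plusSet hL a b).Nonempty := by
        by_contra hne
        rw [Finset.not_nonempty_iff_eq_empty] at hne
        refine ha' (funext fun y => units_eq_of_iff ?_)
        rw [← mem_plusSet_even hL a b, hne]
        simp
      obtain ⟨c', hc', hconn⟩ := hdown _ hne hE0
      have hr := (reach_of_conn hL (le_max_right c' E) (hconn.mono (le_max_left c' E)) 1 1
        (plusSet_one hL).symm).1
      obtain ⟨n, hn⟩ := exists_pathBound hr
      exact ⟨max c' E, max_lt hc' (by linarith), n, Or.inl hn⟩
    · rw [← plusSet_neg_one hL] at hcu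
      have h0 : energy h (plusSet hL (-1) (-1)) ≤ c := by
        rw [plusSet_neg_one, energy_empty]; exact hc.le
      obtain ⟨n, hn⟩ := exists_pathBound (reach_of_conn hL h0 hcu 1 1 (plusSet_one hL).symm).1
      exact ⟨c, by linarith, n, Or.inr hn⟩
  refine ⟨2 * n ^ 2 * Fintype.card (Half L), by positivity, 2 * (E + c - c'), by linarith,
    fun β hβ N => ?_⟩
  have hg := green_le_of_pathBound (halfKernel_nonneg β h) (sum_halfKernel β h)
    (weight_comm hL β h) (halfMeasure_pos β h) (halfMeasure_mul_halfKernel hL β h) ha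
    (one_ne_neg_one L) hn (Real.exp_pos (-2 * β * c'))
    (fun x y hxy => Real.exp_le_exp.2 (by nlinarith)) N
  calc Real.exp (-2 * β * c) * green (halfKernel β h) 1 N (-1) a
      ≤ Real.exp (-2 * β * c) * (2 * n ^ 2 * (Fintype.card (Half L) * Real.exp (-2 * β * E)) /
          Real.exp (-2 * β * c')) := by
        refine mul_le_mul_of_nonneg_left (hg.trans ?_) (Real.exp_pos _).le
        have := hb β hβ
        gcongr
    _ = 2 * n ^ 2 * Fintype.card (Half L) *
          (Real.exp (-2 * β * c) * Real.exp (-2 * β * E) / Real.exp (-2 * β * c')) := by ring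
    _ = _ := by
        rw [← Real.exp_add, ← Real.exp_sub]
        congr 2
        ring

theorem exists_sum_le_exp {A : Type*} (g : A → ℝ → ℕ → ℝ) (s : Finset A)
    (hg : ∀ a ∈ s, ∃ C ≥ 0, ∃ ε > 0, ∀ β > 0, ∀ N, g a β N ≤ C * Real.exp (-β * ε)) :
    ∃ C ≥ 0, ∃ ε > 0, ∀ β > 0, ∀ N, ∑ a ∈ s, g a β N ≤ C * Real.exp (-β * ε) := by
  classical
  induction s using Finset.induction_on with
  | empty => exact ⟨0, le_rfl, 1, one_pos, fun β _ N => by simp⟩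
  | insert a s has ih =>
    obtain ⟨C₁, hC₁, ε₁, hε₁, h₁⟩ := hg a (Finset.mem_insert_self _ _)
    obtain ⟨C₂, hC₂, ε₂, hε₂, h₂⟩ := ih fun b hb => hg b (Finset.mem_insert_of_mem hb)
    refine ⟨C₁ + C₂, add_nonneg hC₁ hC₂, min ε₁ ε₂, lt_min hε₁ hε₂, fun β hβ N => ?_⟩
    rw [Finset.sum_insert has, add_mul]
    have hm : ∀ ε, min ε₁ ε₂ ≤ ε → Real.exp (-β * ε) ≤ Real.exp (-β * min ε₁ ε₂) :=
      fun ε hε => Real.exp_le_exp.2 (by nlinarith)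
    exact add_le_add
      ((h₁ β hβ N).trans (mul_le_mul_of_nonneg_left (hm _ (min_le_left _ _)) hC₁))
      ((h₂ β hβ N).trans (mul_le_mul_of_nonneg_left (hm _ (min_le_right _ _)) hC₂))

theorem exists_firstEntry_le (hL : Even L) {h c : ℝ} (hh : 0 < h) (hc : 0 < c)
    (hbar : ∀ c' < c, ∀ s : Finset (Site L), s.Nonempty →
        Conn (energy h) c' ∅ s → 0 < energy h s) :
    ∃ C ≥ 0, ∀ β > 0, ∀ t,
      firstEntry (halfKernel (L := L) β h) {1} 1 t (-1) ≤ C * Real.exp (-2 * β * c) := by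
  classical
  -- The well of `-1` below level `c`: every edge leaving it has energy at least `c`. The clause `0
  -- ≤ c'` keeps the starting energy below the level.
  set D : Finset (Half L) := Finset.univ.filter fun a =>
    ∃ c' < c, 0 ≤ c' ∧ ∃ b, Conn (energy h) c' ∅ (plusSet hL a b) with hD
  have hm : (-1 : Half L) ∈ D := by
    simp only [hD, Finset.mem_filter, Finset.mem_univ, true_and]
    exact ⟨0, hc, le_rfl, -1, by rw [plusSet_neg_one]; exact .refl⟩
  have hp : (1 : Half L) ∉ D := by
    simp only [hD, Finset.mem_filter, Finset.mem_univ, true_and]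
    rintro ⟨c', hc', h0, b, hb⟩
    have h1 := hb.le (by rwa [energy_empty])
    have hu := energy_univ (L := L) hh
    have h2 := hb.trans (conn_of_left_eq hL h1
      (show energy h (plusSet hL 1 1) ≤ c' by rw [plusSet_one]; linarith))
    rw [plusSet_one] at h2
    exact lt_asymm hu (hbar c' hc' _ ⟨0, Finset.mem_univ _⟩ h2)
  have hcut : ∀ a ∈ D, ∀ b ∈ Dᶜ, c ≤ energy h (plusSet hL a b) := by
    intro a ha b hb
    by_contra! hlt
    simp only [hD, Finset.mem_filter, Finset.mem_univ, true_and, Finset.mem_compl] at ha hb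
    obtain ⟨c', hc', h0, b', hb'⟩ := ha
    have h1 := hb'.le (by rwa [energy_empty])
    refine hb ⟨max c' (energy h (plusSet hL a b)), max_lt hc' hlt, h0.trans (le_max_left _ _), a, ?_⟩
    have h2 := (hb'.mono (le_max_left _ (energy h (plusSet hL a b)))).trans
      (conn_of_left_eq hL (h1.trans (le_max_left _ _)) (le_max_right c' _))
    -- Reflection fixes the empty set and exchanges the halves, so `b` becomes the even half and
    -- would belong to `D`.
    have h3 := Conn.map (reflect L) (energy_map h _ K_reflect) h2
    rwa [map_reflect_plusSet, Finset.map_empty] at h3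
  refine ⟨(D.card : ℝ) * (Dᶜ.card : ℝ), by positivity, fun β hβ t => ?_⟩
  refine (firstEntry_le_cut (halfKernel_nonneg β h) (sum_halfKernel β h)
    (weight_comm hL β h) (halfMeasure_pos β h) (halfMeasure_mul_halfKernel hL β h) hm hp t).trans ?_
  have hmu : 1 ≤ halfMeasure (L := L) β h (-1) := by
    rw [← sum_weight hL]
    have h1 : weight hL β h (-1) (-1) = 1 := by
      rw [weight, plusSet_neg_one, energy_empty]; simp
    rw [← h1]
    exact Finset.single_le_sum (f := fun b => weight hL β h (-1) b)
      (fun b _ => (Real.exp_pos _).le) (Finset.mem_univ _)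
  refine (div_le_self (Finset.sum_nonneg fun a _ => Finset.sum_nonneg fun b _ =>
    (Real.exp_pos _).le) hmu).trans ?_
  rw [mul_assoc, ← nsmul_eq_mul, ← nsmul_eq_mul]
  refine Finset.sum_le_card_nsmul _ _ _ fun a ha => Finset.sum_le_card_nsmul _ _ _ fun b hb => ?_
  exact Real.exp_le_exp.2 (by nlinarith [hcut a ha b hb])

theorem exists_pairBound_le (hL : Even L) {h : ℝ} (h0 : 0 < h) (h1 : h < 1) :
    ∃ C ≥ 0, ∃ ε > 0, ∀ β > 0, ∀ N,
      pairBound (halfKernel (L := L) β h) (-1) 1 N (-1) (-1) ≤ C * Real.exp (-β * ε) := by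
  obtain ⟨c, hc, hbar, hcu, hdown⟩ := exists_energy_barrier (two_le hL) h0 h1
  obtain ⟨C, hC, hq⟩ := exists_firstEntry_le hL h0 hc hbar
  obtain ⟨C', hC', ε, hε, hg⟩ := exists_sum_le_exp
    (fun a β N => Real.exp (-2 * β * c) * green (halfKernel (L := L) β h) 1 N (-1) a)
    ({-1, 1} : Finset (Half L))ᶜ (fun a ha => by
      simp only [Finset.mem_compl, Finset.mem_insert, Finset.mem_singleton, not_or] at ha
      exact exists_green_le hL hc hcu hdown ha.2 ha.1)
  refine ⟨2 * C * (C' + 1), by positivity, min ε (2 * c), lt_min hε (by linarith),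
    fun β hβ N => ?_⟩
  refine (pairBound_le (halfKernel_nonneg β h) (sum_halfKernel β h) (one_ne_neg_one L)
    (hq β hβ) N).trans ?_
  have hgN := hg β hβ (N + 1)
  rw [← Finset.mul_sum] at hgN
  have e1 : Real.exp (-β * ε) ≤ Real.exp (-β * min ε (2 * c)) :=
    Real.exp_le_exp.2 (by nlinarith [min_le_left ε (2 * c)])
  have e2 : Real.exp (-2 * β * c) ≤ Real.exp (-β * min ε (2 * c)) :=
    Real.exp_le_exp.2 (by nlinarith [min_le_right ε (2 * c)])
  have e3 := mul_le_mul_of_nonneg_left e1 hC'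
  calc 2 * (C * Real.exp (-2 * β * c)) * (∑ a ∈ ({-1, 1} : Finset (Half L))ᶜ,
        green (halfKernel β h) 1 (N + 1) (-1) a + 1)
      = 2 * C * (Real.exp (-2 * β * c) * (∑ a ∈ ({-1, 1} : Finset (Half L))ᶜ,
        green (halfKernel β h) 1 (N + 1) (-1) a) + Real.exp (-2 * β * c)) := by ring
    _ ≤ 2 * C * (C' * Real.exp (-β * min ε (2 * c)) + Real.exp (-β * min ε (2 * c))) :=
        mul_le_mul_of_nonneg_left (add_le_add (hgN.trans e3) e2) (by positivity)
    _ = _ := by ring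

/-- The states at which the race between `u` and the checkerboards is decided. -/
def targets (L : ℕ) [NeZero L] : Finset (Config L) := {u L, ce L, co L}

/-- Compare the two recursions in the number of steps. Hitting a checkerboard costs nothing. If one
half is at 1 and the other is off -1, the trivial bound 1 is used. -/
theorem sum_firstEntry_le_pairBound (hL : Even L) (β h : ℝ) (N : ℕ) (q : Half L × Half L) :
    ∑ t ∈ Finset.range N, firstEntry (p β h) (targets L) (u L) t (configEquiv hL q) ≤
      pairBound (halfKernel β h) (-1) 1 N q.1 q.2 := by
  have hu : u L ∈ targets L := by simp [targets]
  induction N generalizing q with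
  | zero => simp [pairBound]
  | succ N ih =>
    set F : Config L → ℝ := fun σ => ∑ t ∈ Finset.range N,
      firstEntry (p β h) (targets L) (u L) t σ with hF
    have hF1 : ∀ σ, F σ ≤ 1 := fun σ => sum_firstEntry_le_one (p_nonneg β h) (sum_p β h) hu N σ
    have hB : ∀ x y, 0 ≤ pairBound (halfKernel (L := L) β h) (-1) 1 N x y :=
      pairBound_nonneg (halfKernel_nonneg β h) _ _ N
    -- A step exchanges the two copies, and the symmetry of the bound absorbs this.
    rw [sum_firstEntry_succ, pairBound_comm]
    have e : p β h (configEquiv hL q) (u L) + ∑ η, killed (p β h) (targets L) (configEquiv hL q) η *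
        F η = ∑ x, ∑ y, halfKernel β h q.2 x * halfKernel β h q.1 y *
          ((if configEquiv hL (x, y) = u L then 1 else 0) +
            if configEquiv hL (x, y) ∈ targets L then 0 else F (configEquiv hL (x, y))) := by
      have : p β h (configEquiv hL q) (u L) =
          ∑ η, p β h (configEquiv hL q) η * (if η = u L then 1 else 0) := by simp
      rw [this, ← Finset.sum_add_distrib, ← (configEquiv hL).sum_comp, Fintype.sum_prod_type]
      refine Finset.sum_congr rfl fun x _ => Finset.sum_congr rfl fun y _ => ?_
      rw [← p_configEquiv hL β h q (x, y), mul_add, killed]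
      congr 1
      split_ifs <;> simp
    rw [e]
    refine sum_le_pairBound_succ (halfKernel_nonneg β h) N (fun x y => ?_) _ _
    have hne := one_ne_neg_one L
    have hBxy := hB x y
    have hFxy := hF1 (configEquiv hL (x, y))
    have hih := ih (x, y)
    simp only [targets, Finset.mem_insert, Finset.mem_singleton, u_eq hL, ce_eq hL, co_eq hL,
      (configEquiv hL).injective.eq_iff, Prod.mk.injEq]
    by_cases hx : x = 1 <;> by_cases hy : y = 1 <;> by_cases hx' : x = -1 <;>
      by_cases hy' : y = -1 <;> simp_all [hne.symm]

end Asymptotics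

end PCA

/-! ### From trajectories to the transition matrix -/

namespace PCA

open FiniteChain

section Trajectories

variable {L : ℕ} [NeZero L]

theorem stepKernel_singleton (β h : ℝ) (σ η : Config L) :
    stepKernel β h σ {η} = ENNReal.ofReal (p β h σ η) := by
  change (∑ η : Config L, ENNReal.ofReal (p β h σ η) • Measure.dirac η) {η} = _
  simp only [Measure.finsetSum_apply, Measure.smul_apply, smul_eq_mul]
  rw [Finset.sum_eq_single η]
  · simp
  · intro b _ hb
    simp [hb]
  · simp

/-- The Markov property. -/
theorem pathLaw_step (β h : ℝ) (ξ σ η : Config L) (n : ℕ)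
    (B : Set ((i : Finset.Iic n) → Config L)) :
    pathLaw β h ξ {ω | Preorder.frestrictLe (π := fun _ => Config L) n ω ∈ B ∧ ω n = σ ∧ ω (n + 1) = η} =
      pathLaw β h ξ {ω | Preorder.frestrictLe (π := fun _ => Config L) n ω ∈ B ∧ ω n = σ} *
        ENNReal.ofReal (p β h σ η) := by
  have hall : ∀ T : Set ((i : Finset.Iic n) → Config L), MeasurableSet T :=
    fun T => T.toFinite.measurableSet
  have key := Kernel.map_frestrictLe_trajMeasure_compProd_eq_map_trajMeasure
    (X := fun _ : ℕ => Config L) (μ₀ := Measure.dirac ξ) (κ := trajStep β h) (a := n)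
  set B' : Set ((i : Finset.Iic n) → Config L) :=
    B ∩ {x | x ⟨n, Finset.mem_Iic.2 le_rfl⟩ = σ} with hB'
  have hm : Measurable (Preorder.frestrictLe (π := fun _ : ℕ => Config L) n) := by fun_prop
  have h1 := congrArg (fun μ => μ (B' ×ˢ {η})) key
  beta_reduce at h1
  rw [Measure.map_apply (by fun_prop) ((hall _).prod (measurableSet_singleton η)),
    Measure.compProd_apply_prod (hall _) (measurableSet_singleton η),
    setLIntegral_congr_fun (g := fun _ => ENNReal.ofReal (p β h σ η)) (hall _), setLIntegral_const,
    Measure.map_apply hm (hall _)] at h1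
  · rw [mul_comm]
    exact (congrArg _ (Set.ext fun ω => and_assoc.symm)).trans h1.symm
  · intro x hx
    rw [← stepKernel_singleton, ← hx.2]
    rfl

theorem pathLaw_zero (β h : ℝ) (ξ σ : Config L) :
    pathLaw β h ξ {ω | ω 0 = σ} = if ξ = σ then 1 else 0 := by
  have hall : ∀ T : Set ((i : Finset.Iic 0) → Config L), MeasurableSet T :=
    fun T => T.toFinite.measurableSet
  have hm : Measurable (Preorder.frestrictLe (π := fun _ : ℕ => Config L) 0) := by fun_prop
  have key : (pathLaw β h ξ).map (Preorder.frestrictLe (π := fun _ : ℕ => Config L) 0) =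
      (Measure.dirac ξ).map (MeasurableEquiv.piUnique (fun _ : Finset.Iic 0 => Config L)).symm := by
    rw [pathLaw, Kernel.trajMeasure, Measure.map_comp _ _ (by fun_prop),
      Kernel.traj_map_frestrictLe, Kernel.partialTraj_self, Measure.id_comp]
  have h1 := congrArg (fun μ => μ {x | x ⟨0, Finset.mem_Iic.2 le_rfl⟩ = σ}) key
  beta_reduce at h1
  rw [Measure.map_apply hm (hall _), Measure.map_apply (by fun_prop) (hall _),
    Measure.dirac_apply] at h1
  refine (show pathLaw β h ξ {ω | ω 0 = σ} = _ from h1).trans ?_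
  split_ifs with hσ
  · rw [Set.indicator_of_mem]
    · rfl
    · exact hσ
  · rw [Set.indicator_of_notMem]
    exact hσ

/-- The trajectories that are at `σ` at time `n` and have avoided `T` at the times `1, …, n`. -/
def avoiding (T : Finset (Config L)) (n : ℕ) (σ : Config L) : Set (ℕ → Config L) :=
  {ω | (∀ k, 1 ≤ k → k ≤ n → ω k ∉ T) ∧ ω n = σ}

theorem pathLaw_avoiding_step (β h : ℝ) (ξ σ η : Config L) (T : Finset (Config L)) (n : ℕ) :
    pathLaw β h ξ (avoiding T n σ ∩ {ω | ω (n + 1) = η}) =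
      pathLaw β h ξ (avoiding T n σ) * ENNReal.ofReal (p β h σ η) := by
  have := pathLaw_step β h ξ σ η n
    {x | ∀ k (hk : k ∈ Finset.Iic n), 1 ≤ k → x ⟨k, hk⟩ ∉ T}
  convert this using 3
  · ext ω
    simp only [avoiding, Set.mem_inter_iff, Set.mem_ofPred_eq, Finset.mem_Iic, and_assoc]
    exact and_congr_left fun _ => ⟨fun h k hk hk' => h k hk' hk, fun h k hk hk' => h k hk' hk⟩
  · ext ω
    simp only [avoiding, Set.mem_ofPred_eq, Finset.mem_Iic]
    exact and_congr_left fun _ => ⟨fun h k hk hk' => h k hk' hk, fun h k hk hk' => h k hk' hk⟩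

theorem sum_pathLaw_avoiding (β h : ℝ) (ξ η : Config L) (T : Finset (Config L)) (n : ℕ) :
    pathLaw β h ξ {ω | (∀ k, 1 ≤ k → k ≤ n → ω k ∉ T) ∧ ω (n + 1) = η} ≤
      ∑ σ, pathLaw β h ξ (avoiding T n σ) * ENNReal.ofReal (p β h σ η) := by
  simp_rw [← pathLaw_avoiding_step]
  refine (measure_mono ?_).trans (measure_iUnion_fintype_le _ _)
  rintro ω ⟨h1, h2⟩
  exact Set.mem_iUnion.2 ⟨ω n, ⟨h1, rfl⟩, h2⟩

theorem pathLaw_avoiding_le (β h : ℝ) (ξ σ : Config L) (T : Finset (Config L)) (n : ℕ) :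
    pathLaw β h ξ (avoiding T n σ) ≤ ENNReal.ofReal ((killed (p β h) T ^ n) ξ σ) := by
  induction n generalizing σ with
  | zero =>
    refine (measure_mono fun ω hω => hω.2).trans ((pathLaw_zero β h ξ σ).trans_le ?_)
    rw [pow_zero, Matrix.one_apply]
    split_ifs <;> simp
  | succ n ih =>
    by_cases hσ : σ ∈ T
    · have : avoiding T (n + 1) σ = ∅ := by
        ext ω
        simp only [avoiding, Set.mem_ofPred_eq, Set.mem_empty_iff_false, iff_false, not_and]
        exact fun h1 h2 => h1 (n + 1) (by omega) le_rfl (h2 ▸ hσ)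
      rw [this]; simp
    · refine (measure_mono ?_).trans ((sum_pathLaw_avoiding β h ξ σ T n).trans ?_)
      · exact fun ω hω => ⟨fun k h1 h2 => hω.1 k h1 (by omega), hω.2⟩
      · rw [pow_succ, Matrix.mul_apply, ENNReal.ofReal_sum_of_nonneg fun τ _ =>
          mul_nonneg (pow_entry_nonneg (killed_nonneg (p_nonneg β h) T) n ξ τ)
            (killed_nonneg (p_nonneg β h) T τ σ)]
        refine Finset.sum_le_sum fun τ _ => ?_
        rw [ENNReal.ofReal_mul (pow_entry_nonneg (killed_nonneg (p_nonneg β h) T) n ξ τ), killed,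
          if_neg hσ]
        exact mul_le_mul_left (ih τ) _

theorem pathLaw_firstEntry_le (β h : ℝ) (ξ η : Config L) (T : Finset (Config L)) (n : ℕ) :
    pathLaw β h ξ {ω | (∀ k, 1 ≤ k → k ≤ n → ω k ∉ T) ∧ ω (n + 1) = η} ≤
      ENNReal.ofReal (firstEntry (p β h) T η n ξ) := by
  refine (sum_pathLaw_avoiding β h ξ η T n).trans ?_
  unfold firstEntry Matrix.mulVec dotProduct
  rw [ENNReal.ofReal_sum_of_nonneg fun τ _ =>
    mul_nonneg (pow_entry_nonneg (killed_nonneg (p_nonneg β h) T) n ξ τ) (p_nonneg β h τ η)]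
  refine Finset.sum_le_sum fun τ _ => ?_
  rw [ENNReal.ofReal_mul (pow_entry_nonneg (killed_nonneg (p_nonneg β h) T) n ξ τ)]
  exact mul_le_mul_left (pathLaw_avoiding_le β h ξ τ T n) _

/-- Hitting times count positive times only, so the first visit to `u` is at some time n + 1, with
no target met at times 1, …, n. -/
theorem hitTime_lt_subset : {ω | hitTime {u L} ω < hitTime (c L) ω} ⊆
    ⋃ n, {ω | (∀ k, 1 ≤ k → k ≤ n → ω k ∉ targets L) ∧ ω (n + 1) = u L} := by
  intro ω hω
  simp only [Set.mem_ofPred_eq] at hω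
  have hex : ∃ n, ω (n + 1) = u L := by
    by_contra! hno
    have htop : hitTime {u L} ω = ⊤ := by
      refine hittingAfter_eq_top_iff.2 fun j hj => ?_
      obtain ⟨i, rfl⟩ : ∃ i, j = i + 1 := ⟨j - 1, by omega⟩
      exact hno i
    exact not_top_lt (htop ▸ hω)
  classical
  refine Set.mem_iUnion.2 ⟨Nat.find hex, fun k hk1 hkn hkT => ?_, Nat.find_spec hex⟩
  obtain ⟨i, rfl⟩ : ∃ i, k = i + 1 := ⟨k - 1, by omega⟩
  have hiu : ω (i + 1) ≠ u L := Nat.find_min hex (by omega)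
  have hic : ω (i + 1) ∈ c L := by
    simp only [targets, Finset.mem_insert, Finset.mem_singleton] at hkT
    exact hkT.resolve_left hiu
  have h1 : hitTime (c L) ω ≤ ((i + 1 : ℕ) : WithTop ℕ) :=
    hittingAfter_le_of_mem (u := fun t (ω : ℕ → Config L) => ω t) hk1 hic
  have h2 : hitTime {u L} ω < ((i + 1 : ℕ) : WithTop ℕ) := hω.trans_le h1
  obtain ⟨j, ⟨hj1, hji⟩, hju⟩ :=
    (hittingAfter_lt_iff (u := fun t (ω : ℕ → Config L) => ω t) (i := i + 1)).1 h2
  obtain ⟨j, rfl⟩ : ∃ i, j = i + 1 := ⟨j - 1, by omega⟩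
  exact Nat.find_min hex (by omega) hju

theorem pathLaw_hitTime_lt_le (hL : Even L) (β h : ℝ) {B : ℝ}
    (hB : ∀ N, pairBound (halfKernel (L := L) β h) (-1) 1 N (-1) (-1) ≤ B) :
    (pathLaw β h (d L)).real {ω | hitTime {u L} ω < hitTime (c L) ω} ≤ B := by
  have hB0 : 0 ≤ B := (pairBound_nonneg (halfKernel_nonneg β h) _ _ 0 _ _).trans (hB 0)
  refine ENNReal.toReal_le_of_le_ofReal hB0 ?_
  refine (measure_mono hitTime_lt_subset).trans ((measure_iUnion_le _).trans ?_)
  refine (ENNReal.tsum_le_tsum fun n =>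
    pathLaw_firstEntry_le β h (d L) (u L) (targets L) n).trans ?_
  refine ENNReal.tsum_le_of_sum_range_le fun N => ?_
  rw [← ENNReal.ofReal_sum_of_nonneg fun t _ => firstEntry_nonneg (p_nonneg β h) _ _ t _]
  refine ENNReal.ofReal_le_ofReal (le_trans ?_ (hB N))
  rw [d_eq hL]
  exact sum_firstEntry_le_pairBound hL β h N (-1, -1)

end Trajectories

end PCA

/-! ### Conclusion -/

theorem mainTheorem4 (L : ℕ) [NeZero L] (hL : Even L) (h : ℝ) (h_pos : 0 < h) (h_lt : h < 1) :
    ∃ lam : ℝ, 0 < lam ∧ ∃ β₀ : ℝ, 0 < β₀ ∧ ∀ β : ℝ, β₀ < β →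
      (PCA.pathLaw β h (PCA.d L)).real
          {ω | PCA.hitTime {PCA.u L} ω < PCA.hitTime (PCA.c L) ω} ≤
        Real.exp (-β * lam) := by
  obtain ⟨C, hC, ε, hε, hB⟩ := PCA.exists_pairBound_le (L := L) hL h_pos h_lt
  -- Half of the rate absorbs the prefactor: β > 2C/ε gives C ≤ βε/2 ≤ exp(βε/2). The added 1 keeps
  -- the threshold positive when C = 0.
  refine ⟨ε / 2, by linarith, 2 * C / ε + 1, by positivity, fun β hβ => ?_⟩
  have h1 : 2 * C / ε < β := by linarith
  have hβ0 : 0 < β := lt_of_le_of_lt (by positivity) h1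
  refine (PCA.pathLaw_hitTime_lt_le hL β h (hB β hβ0)).trans ?_
  rw [div_lt_iff₀ hε] at h1
  have h2 : C ≤ Real.exp (β * (ε / 2)) := by
    have := Real.add_one_le_exp (β * (ε / 2))
    linarith
  calc C * Real.exp (-β * ε) ≤ Real.exp (β * (ε / 2)) * Real.exp (-β * ε) :=
        mul_le_mul_of_nonneg_right h2 (Real.exp_pos _).le
    _ = Real.exp (-β * (ε / 2)) := by
        rw [← Real.exp_add]; congr 1; ring
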